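/- Let $k$ be a field and let $Q=(Q_0,Q_1,s,t)$ be a quiver (possibly infinite) with only finitely many arrows from $x$ to $y$ for any two vertices $x,y$. Then the path coalgebra $kQ$ admits a coquasitriangular Majid algebra structure if and only if $Q$ is isomorphic to a Hopf quiver $Q(G,R)$ where $G$ is an abelian group and $R$ is a ramification datum of $G$. Here the terms have the following meaning; $\otimes$ is over $k$, and $\Delta(a)=a_1\otimes a_2$ is Sweedler notation. *Path coalgebra.* $kQ$ has as basis all paths of $Q$ of length $\ge 0$, with $\Delta(p)=\sum_{i=0}^{l} a_l\cdots a_{i+1}\otimes a_i\cdots a_1$ for a path $p=a_l\cdots a_1$ (empty products are the corresponding vertices), $\varepsilon(p)=1$ if $p$ is a vertex and $\varepsilon(p)=0$ otherwise. *Hopf quiver.* A ramification datum of a group $G$ is a formal sum $R=\sum_{C}R_C\,C$ over all conjugacy classes $C$ of $G$ with $R_C\in\mathbb N=\{0,1,2,\dots\}$. The quiver $Q(G,R)$ has vertex set $G$ and, for each $x\in G$ and each $c\in C$, exactly $R_C$ arrows from $x$ to $cx$. *Majid algebra.* A Majid algebra structure on a coalgebra $H$ consists of a coalgebra map $H\otimes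 H\to H$, $a\otimes b\mapsto ab$, an element $1\in H$ such that $\lambda\mapsto\lambda 1$ is a coalgebra map $k\to H$, a convolution-invertible linear map $\Phi:H\otimes H\otimes H\to k$ (the associator), a coalgebra antimorphism $S:H\to H$, and linear maps $\alpha,\beta:H\to k$, such that for all $a,b,c,d\in H$ $$1a=a=a1,\qquad a_1(b_1c_1)\,\Phi(a_2,b_2,c_2)=\Phi(a_1,b_1,c_1)\,(a_2b_2)c_2,\qquad \Phi(a,1,b)=\varepsilon(a)\varepsilon(b),$$ $$\Phi(a_1,b_1,c_1d_1)\,\Phi(a_2b_2,c_2,d_2)=\Phi(b_1,c_1,d_1)\,\Phi(a_1,b_2c_2,d_2)\,\Phi(a_2,b_3,c_3),$$ $$S(a_1)\alpha(a_2)a_3=\alpha(a)1,\qquad a_1\beta(a_2)S(a_3)=\beta(a)1,$$ $$\Phi(a_1,S(a_3),a_5)\,\beta(a_2)\,\alpha(a_4)=\varepsilon(a)=\Phi^{-1}(S(a_1),a_3,S(a_5))\,\alpha(a_2)\,\beta(a_4).$$ *Coquasitriangular.* Such a structure is coquasitriangular if there is a convolution-invertible linear map $\mathcal R:H\otimes H\to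 k$ such that for all $a,b,c\in H$ $$\mathcal R(ab,c)=\Phi(c_1,a_1,b_1)\,\mathcal R(a_2,c_2)\,\Phi^{-1}(a_3,c_3,b_2)\,\mathcal R(b_3,c_4)\,\Phi(a_4,b_4,c_5),$$ $$\mathcal R(a,bc)=\Phi^{-1}(b_1,c_1,a_1)\,\mathcal R(a_2,c_2)\,\Phi(b_2,a_3,c_3)\,\mathcal R(a_4,b_3)\,\Phi^{-1}(a_5,b_4,c_4),$$ $$b_1a_1\,\mathcal R(a_2,b_2)=\mathcal R(a_1,b_1)\,a_2b_2.$$ -/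

import Mathlib

open TensorProduct

universe u v w

/-! ## Quivers and path coalgebras -/

/-- An isomorphism of quivers: a bijection on vertices, together with bijections between the
sets of arrows with corresponding source and target. -/
structure QuiverIso (V : Type*) (W : Type*) [Quiver V] [Quiver W] where
  vertexEquiv : V ≃ W
  arrowEquiv : ∀ x y : V, (x ⟶ y) ≃ (vertexEquiv x ⟶ vertexEquiv y)

/-- The set of all paths of a quiver (of any length `≥ 0`, with any source and target). -/
abbrev PathIndex (V : Type u) [Quiver.{w} V] : Type max u w :=
  Σ (a : V) (b : V), Quiver.Path a b

/-- The path space `kQ`: the vector space with basis the set of all paths. -/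
def PathCoalgebra (k : Type v) [Field k] (V : Type u) [Quiver.{w} V] : Type max u v w :=
  PathIndex V →₀ k

namespace PathCoalgebra

noncomputable section

variable (k : Type v) [Field k] {V : Type u} [Quiver.{w} V]

instance : AddCommGroup (PathCoalgebra k V) := inferInstanceAs (AddCommGroup (PathIndex V →₀ k))

instance : Module k (PathCoalgebra k V) := inferInstanceAs (Module k (PathIndex V →₀ k))

/-- The basis of `kQ` that consists of the paths. -/
def pathBasis : Module.Basis (PathIndex V) k (PathCoalgebra k V) := Module.Basis.ofRepr (.refl k _)

/-- A path, as an element of `kQ`. -/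
def ofPath {a b : V} (p : Quiver.Path a b) : PathCoalgebra k V := pathBasis k ⟨a, b, p⟩

/-- The list of all ways to split a path `p = a_l ⋯ a_1` from `a` to `b` into a terminal part
`a_l ⋯ a_{i+1}` (first entry) and an initial part `a_i ⋯ a_1` (second entry), `0 ≤ i ≤ l`. -/
def splits {a : V} : {b : V} → Quiver.Path a b → List (Σ c : V, Quiver.Path c b × Quiver.Path a c)
  | _, .nil => [⟨a, .nil, .nil⟩]
  | b, .cons p e => ⟨b, .nil, p.cons e⟩ :: (splits p).map fun s => ⟨s.1, s.2.1.cons e, s.2.2⟩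

/-- `Δ(p) = ∑ a_l ⋯ a_{i+1} ⊗ a_i ⋯ a_1` for a path `p = a_l ⋯ a_1`. -/
def comulPath {a b : V} (p : Quiver.Path a b) : PathCoalgebra k V ⊗[k] PathCoalgebra k V :=
  ((splits p).map fun s => ofPath k s.2.1 ⊗ₜ[k] ofPath k s.2.2).sum

/-- `ε(p) = 1` for a path of length `0` (a vertex) and `ε(p) = 0` for a longer path. -/
def counitPath {a b : V} (p : Quiver.Path a b) : k := if p.length = 0 then 1 else 0

instance : CoalgebraStruct k (PathCoalgebra k V) where
  comul := (pathBasis k).constr k fun p => comulPath k p.2.2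
  counit := (pathBasis k).constr k fun p => counitPath k p.2.2

@[simp]
theorem comul_ofPath {a b : V} (p : Quiver.Path a b) :
    CoalgebraStruct.comul (R := k) (ofPath k p) = comulPath k p :=
  (pathBasis k).constr_basis k _ _

@[simp]
theorem counit_ofPath {a b : V} (p : Quiver.Path a b) :
    CoalgebraStruct.counit (R := k) (ofPath k p) = counitPath k p :=
  (pathBasis k).constr_basis k _ _

/-- The linear map that prolongs each path ending at the source of `e` by the arrow `e`. -/
def prolong {b c : V} (e : b ⟶ c) : PathCoalgebra k V →ₗ[k] PathCoalgebra k V :=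
  open Classical in
  (pathBasis k).constr k fun p => if h : p.2.1 = b then ofPath k ((h ▸ p.2.2).cons e) else 0

theorem prolong_ofPath {a b c : V} (p : Quiver.Path a b) (e : b ⟶ c) :
    prolong k e (ofPath k p) = ofPath k (p.cons e) := by
  refine ((pathBasis k).constr_basis k _ _).trans ?_
  simp

theorem comulPath_nil (a : V) :
    comulPath k (Quiver.Path.nil : Quiver.Path a a) = 
      ofPath k (.nil : Quiver.Path a a) ⊗ₜ ofPath k (.nil : Quiver.Path a a) := by
  simp [comulPath, splits]

theorem comulPath_cons {a b c : V} (p : Quiver.Path a b) (e : b ⟶ c) :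
    comulPath k (p.cons e) =
      ofPath k (.nil : Quiver.Path c c) ⊗ₜ ofPath k (p.cons e) +
        (prolong k e).rTensor _ (comulPath k p) := by
  simp [comulPath, splits, map_list_sum, Function.comp_def, prolong_ofPath]

theorem comulPath_eq_induction {M : Type*} [AddCommGroup M] [Module k M] {a b : V}
    (p : Quiver.Path a b) (f g : PathCoalgebra k V ⊗[k] PathCoalgebra k V →ₗ[k] M)
    (h : ∀ (c : V) (q : Quiver.Path c b) (r : Quiver.Path a c),
      f (ofPath k q ⊗ₜ ofPath k r) = g (ofPath k q ⊗ₜ ofPath k r)) :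
    f (comulPath k p) = g (comulPath k p) := by
  simp only [comulPath, map_list_sum, List.map_map, Function.comp_def]
  congr 2
  funext s
  exact h _ _ _

theorem coassoc_ofPath {a b : V} (p : Quiver.Path a b) :
    TensorProduct.assoc k _ _ _
        ((CoalgebraStruct.comul (R := k)).rTensor (PathCoalgebra k V) (comulPath k p)) =
      (CoalgebraStruct.comul (R := k)).lTensor (PathCoalgebra k V) (comulPath k p) := by
  induction p with
  | nil => simp [comulPath_nil]
  | @cons b c p e ih =>
    have h1 := comulPath_eq_induction k p
      ((TensorProduct.assoc k _ _ _).toLinearMap ∘ₗ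
        (CoalgebraStruct.comul (R := k)).rTensor (PathCoalgebra k V) ∘ₗ (prolong k e).rTensor _)
      (TensorProduct.mk k _ _ (ofPath k (.nil : Quiver.Path c c)) ∘ₗ (prolong k e).rTensor _ +
        (prolong k e).rTensor _ ∘ₗ (TensorProduct.assoc k _ _ _).toLinearMap ∘ₗ
        (CoalgebraStruct.comul (R := k)).rTensor (PathCoalgebra k V)) (by
          intro d q r
          have h2 : ∀ x : PathCoalgebra k V ⊗[k] PathCoalgebra k V,
              TensorProduct.assoc k _ _ _ ((prolong k e).rTensor _ x ⊗ₜ[k] ofPath k r) =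
              (prolong k e).rTensor _ (TensorProduct.assoc k _ _ _ (x ⊗ₜ[k] ofPath k r)) := by
            intro x
            induction x with
            | zero => simp
            | tmul x y => simp
            | add x y hx hy => simp only [map_add, add_tmul, hx, hy]
          simp [prolong_ofPath, comulPath_cons, add_tmul, h2])
    have h3 := comulPath_eq_induction k p
      ((CoalgebraStruct.comul (R := k)).lTensor (PathCoalgebra k V) ∘ₗ (prolong k e).rTensor _)
      ((prolong k e).rTensor _ ∘ₗ (CoalgebraStruct.comul (R := k)).lTensor (PathCoalgebra k V))
      (by intro d q r; simp)
    simp only [LinearMap.coe_comp, Function.comp_apply, LinearMap.add_apply,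
      LinearEquiv.coe_coe, TensorProduct.mk_apply] at h1 h3
    rw [comulPath_cons, map_add, map_add, map_add, h1, h3, ih]
    simp [comulPath_nil, comulPath_cons, tmul_add, add_assoc]

theorem counit_left_ofPath {a b : V} (p : Quiver.Path a b) :
    (CoalgebraStruct.counit (R := k)).rTensor (PathCoalgebra k V) (comulPath k p) =
      1 ⊗ₜ ofPath k p := by
  cases p with
  | nil => simp [comulPath_nil, counitPath]
  | @cons b c p e =>
    have h := comulPath_eq_induction k p
      ((CoalgebraStruct.counit (R := k)).rTensor (PathCoalgebra k V) ∘ₗ (prolong k e).rTensor _) 0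
      (by intro d q r; simp [prolong_ofPath, counitPath])
    simp only [LinearMap.coe_comp, Function.comp_apply, LinearMap.zero_apply] at h
    rw [comulPath_cons, map_add, h]
    simp [counitPath]

theorem counit_right_ofPath {a b : V} (p : Quiver.Path a b) :
    (CoalgebraStruct.counit (R := k)).lTensor (PathCoalgebra k V) (comulPath k p) =
      ofPath k p ⊗ₜ 1 := by
  induction p with
  | nil => simp [comulPath_nil, counitPath]
  | @cons b c p e ih =>
    have h := comulPath_eq_induction k p
      ((CoalgebraStruct.counit (R := k)).lTensor (PathCoalgebra k V) ∘ₗ (prolong k e).rTensor _)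
      ((prolong k e).rTensor _ ∘ₗ (CoalgebraStruct.counit (R := k)).lTensor (PathCoalgebra k V))
      (by intro d q r; simp)
    simp only [LinearMap.coe_comp, Function.comp_apply] at h
    rw [comulPath_cons, map_add, h, ih]
    simp [counitPath, prolong_ofPath]

/-- The path coalgebra `kQ`. -/
instance : Coalgebra k (PathCoalgebra k V) where
  coassoc := (pathBasis k).ext fun p => by
    simpa using! (comul_ofPath k p.2.2).symm ▸ coassoc_ofPath k p.2.2
  rTensor_counit_comp_comul := (pathBasis k).ext fun p => by
    simpa using! (comul_ofPath k p.2.2).symm ▸ counit_left_ofPath k p.2.2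
  lTensor_counit_comp_comul := (pathBasis k).ext fun p => by
    simpa using! (comul_ofPath k p.2.2).symm ▸ counit_right_ofPath k p.2.2

end

end PathCoalgebra

/-! ## Hopf quivers -/

/-- The Hopf quiver `Q(G,R)` of a group `G` and a ramification datum `R = ∑ R_C C`, where `C`
runs over the conjugacy classes of `G` and `R_C ∈ ℕ`: its vertices are the elements of `G`. -/
@[nolint unusedArguments]
def HopfQuiver {G : Type u} [Group G] (_R : ConjClasses G → ℕ) : Type u := G

/-- For `x ∈ G` and `c ∈ C` there are `R_C` arrows from `x` to `c x`.  So the arrows from `x` to `y`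
are counted by the class of the only `c` with `c x = y`. -/
instance {G : Type u} [Group G] (R : ConjClasses G → ℕ) : Quiver.{0} (HopfQuiver R) where
  Hom := fun (x y : G) => Fin (R (ConjClasses.mk (y * x⁻¹)))

/-! ## Majid algebras

Identities between functionals on `H ⊗ (H ⊗ H)` etc. are stated in the convolution algebra
`(φ * ψ)(x) = φ(x₁) ψ(x₂)` of the tensor product coalgebra.  For example, the functional
`a ⊗ b ⊗ c ↦ R(a₁,c₁) Φ(a₂,b,c₂)` is the convolution product of
`a ⊗ b ⊗ c ↦ ε(b) R(a,c)` and `Φ`. -/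

/-- The convolution algebra of linear functionals on a coalgebra. -/
abbrev ConvDual (k : Type*) (C : Type*) [Field k] [AddCommGroup C] [Module k C] :=
  WithConv (C →ₗ[k] k)

section Majid

variable {k : Type*} [Field k]

/-- The functional `φ ∘ f`. -/
def ConvDual.comap {C D : Type*} [AddCommGroup C] [Module k C] [AddCommGroup D] [Module k D]
    (φ : ConvDual k D) (f : C →ₗ[k] D) : ConvDual k C :=
  WithConv.toConv (φ.ofConv ∘ₗ f)

/-- `x ↦ φ(x₁) f(x₂)`. -/
noncomputable def convLeft {C M : Type*} [AddCommGroup C] [Module k C] [Coalgebra k C]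
    [AddCommGroup M] [Module k M] (φ : C →ₗ[k] k) (f : C →ₗ[k] M) : C →ₗ[k] M :=
  (TensorProduct.lid k M).toLinearMap ∘ₗ TensorProduct.map φ f ∘ₗ Coalgebra.comul

/-- `x ↦ f(x₁) φ(x₂)`. -/
noncomputable def convRight {C M : Type*} [AddCommGroup C] [Module k C] [Coalgebra k C]
    [AddCommGroup M] [Module k M] (f : C →ₗ[k] M) (φ : C →ₗ[k] k) : C →ₗ[k] M :=
  (TensorProduct.rid k M).toLinearMap ∘ₗ TensorProduct.map f φ ∘ₗ Coalgebra.comul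

/-- `a ⊗ x ↦ ε(a) x`. -/
noncomputable def counitLeft (A M : Type*) [AddCommGroup A] [Module k A] [Coalgebra k A]
    [AddCommGroup M] [Module k M] : A ⊗[k] M →ₗ[k] M :=
  (TensorProduct.lid k M).toLinearMap ∘ₗ (Coalgebra.counit (R := k) (A := A)).rTensor M

/-- `x ⊗ a ↦ ε(a) x`. -/
noncomputable def counitRight (M A : Type*) [AddCommGroup A] [Module k A] [Coalgebra k A]
    [AddCommGroup M] [Module k M] : M ⊗[k] A →ₗ[k] M :=
  (TensorProduct.rid k M).toLinearMap ∘ₗ (Coalgebra.counit (R := k) (A := A)).lTensor M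

/-- `a ⊗ (b ⊗ c) ↦ (a ⊗ b) ⊗ c`. -/
noncomputable def assocInv (A B C : Type*) [AddCommGroup A] [Module k A] [AddCommGroup B]
    [Module k B] [AddCommGroup C] [Module k C] : A ⊗[k] (B ⊗[k] C) →ₗ[k] (A ⊗[k] B) ⊗[k] C :=
  (TensorProduct.assoc k A B C).symm.toLinearMap

end Majid

/-- A Majid algebra (dual quasi-Hopf algebra) structure on a coalgebra `H` over a field `k`. -/
structure MajidAlgebra (k : Type*) (H : Type*) [Field k] [AddCommGroup H] [Module k H]
    [Coalgebra k H] where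
  /-- The multiplication, a homomorphism of coalgebras; it need not be associative. -/
  mul : H ⊗[k] H →ₗc[k] H
  /-- The unit element; being group-like means that `λ ↦ λ 1` is a homomorphism of coalgebras. -/
  one : H
  isGroupLikeElem_one : IsGroupLikeElem k one
  one_mul : ∀ a : H, mul (one ⊗ₜ a) = a
  mul_one : ∀ a : H, mul (a ⊗ₜ one) = a
  /-- The associator `Φ : H ⊗ H ⊗ H → k`, a convolution-invertible functional. -/
  Φ : (ConvDual k (H ⊗[k] (H ⊗[k] H)))ˣ
  /-- `a₁(b₁c₁) Φ(a₂,b₂,c₂) = Φ(a₁,b₁,c₁) (a₂b₂)c₂`. -/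
  quasi_assoc :
    convRight (mul.toLinearMap ∘ₗ mul.toLinearMap.lTensor H) Φ.val.ofConv =
      convLeft Φ.val.ofConv (mul.toLinearMap ∘ₗ mul.toLinearMap.rTensor H ∘ₗ assocInv H H H)
  /-- `Φ(a₁,b₁,c₁d₁) Φ(a₂b₂,c₂,d₂) = Φ(b₁,c₁,d₁) Φ(a₁,b₂c₂,d₂) Φ(a₂,b₃,c₃)`. -/
  pentagon :
    Φ.val.comap ((mul.toLinearMap.lTensor H).lTensor H) *
        Φ.val.comap (mul.toLinearMap.rTensor (H ⊗[k] H) ∘ₗ assocInv H H (H ⊗[k] H)) =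
      Φ.val.comap (counitLeft H (H ⊗[k] (H ⊗[k] H))) *
        Φ.val.comap ((mul.toLinearMap.rTensor H ∘ₗ assocInv H H H).lTensor H) *
        Φ.val.comap (((counitRight H H).lTensor H).lTensor H)
  /-- `Φ(a,1,b) = ε(a) ε(b)`. -/
  Φ_one : ∀ a b : H, Φ.val (a ⊗ₜ (one ⊗ₜ b)) =
    Coalgebra.counit (R := k) a * Coalgebra.counit (R := k) b
  /-- The quasi-antipode `(S, α, β)`, where `S` is a coalgebra antimorphism. -/
  S : H →ₗ[k] H
  α : H →ₗ[k] k
  β : H →ₗ[k] k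
  counit_S : Coalgebra.counit ∘ₗ S = Coalgebra.counit (R := k) (A := H)
  /-- `Δ(S(a)) = S(a₂) ⊗ S(a₁)`. -/
  comul_S : Coalgebra.comul ∘ₗ S =
    (TensorProduct.comm k H H).toLinearMap ∘ₗ TensorProduct.map S S ∘ₗ Coalgebra.comul
  /-- `S(a₁) α(a₂) a₃ = α(a) 1`. -/
  S_α : mul.toLinearMap ∘ₗ TensorProduct.map S (convLeft α LinearMap.id) ∘ₗ Coalgebra.comul =
    α.smulRight one
  /-- `a₁ β(a₂) S(a₃) = β(a) 1`. -/
  β_S : mul.toLinearMap ∘ₗ TensorProduct.map LinearMap.id (convLeft β S) ∘ₗ Coalgebra.comul =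
    β.smulRight one
  /-- `Φ(a₁,S(a₃),a₅) β(a₂) α(a₄) = ε(a)`. -/
  Φ_S : Φ.val.ofConv ∘ₗ
      TensorProduct.map (convRight LinearMap.id β)
        (TensorProduct.map (convRight S α) LinearMap.id) ∘ₗ
      Coalgebra.comul.lTensor H ∘ₗ Coalgebra.comul = Coalgebra.counit
  /-- `Φ⁻¹(S(a₁),a₃,S(a₅)) α(a₂) β(a₄) = ε(a)`. -/
  Φ_inv_S : Φ⁻¹.val.ofConv ∘ₗ
      TensorProduct.map (convRight S α)
        (TensorProduct.map (convRight LinearMap.id β) S) ∘ₗ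
      Coalgebra.comul.lTensor H ∘ₗ Coalgebra.comul = Coalgebra.counit

section Permutations

variable (k : Type*) [Field k] (H : Type*) [AddCommGroup H] [Module k H]

/-- `a ⊗ (b ⊗ c) ↦ c ⊗ (a ⊗ b)`. -/
noncomputable def permCAB : H ⊗[k] (H ⊗[k] H) →ₗ[k] H ⊗[k] (H ⊗[k] H) :=
  (TensorProduct.comm k (H ⊗[k] H) H).toLinearMap ∘ₗ assocInv H H H

/-- `a ⊗ (b ⊗ c) ↦ b ⊗ (c ⊗ a)`. -/
noncomputable def permBCA : H ⊗[k] (H ⊗[k] H) →ₗ[k] H ⊗[k] (H ⊗[k] H) :=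
  (TensorProduct.assoc k H H H).toLinearMap ∘ₗ (TensorProduct.comm k H (H ⊗[k] H)).toLinearMap

/-- `a ⊗ (b ⊗ c) ↦ a ⊗ (c ⊗ b)`. -/
noncomputable def permACB : H ⊗[k] (H ⊗[k] H) →ₗ[k] H ⊗[k] (H ⊗[k] H) :=
  (TensorProduct.comm k H H).toLinearMap.lTensor H

/-- `a ⊗ (b ⊗ c) ↦ b ⊗ (a ⊗ c)`. -/
noncomputable def permBAC : H ⊗[k] (H ⊗[k] H) →ₗ[k] H ⊗[k] (H ⊗[k] H) :=
  (TensorProduct.leftComm k H H H).toLinearMap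

variable [Coalgebra k H]

/-- `a ⊗ (b ⊗ c) ↦ ε(b) a ⊗ c`. -/
noncomputable def dropB : H ⊗[k] (H ⊗[k] H) →ₗ[k] H ⊗[k] H := (counitLeft H H).lTensor H

/-- `a ⊗ (b ⊗ c) ↦ ε(a) b ⊗ c`. -/
noncomputable def dropA : H ⊗[k] (H ⊗[k] H) →ₗ[k] H ⊗[k] H := counitLeft H (H ⊗[k] H)

/-- `a ⊗ (b ⊗ c) ↦ ε(c) a ⊗ b`. -/
noncomputable def dropC : H ⊗[k] (H ⊗[k] H) →ₗ[k] H ⊗[k] H := (counitRight H H).lTensor H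

end Permutations

/-- A coquasitriangular structure on a Majid algebra. -/
structure CoquasitriangularStructure {k : Type*} {H : Type*} [Field k] [AddCommGroup H]
    [Module k H] [Coalgebra k H] (M : MajidAlgebra k H) where
  /-- The convolution-invertible functional `R : H ⊗ H → k`. -/
  R : (ConvDual k (H ⊗[k] H))ˣ
  /-- `R(ab,c) = Φ(c₁,a₁,b₁) R(a₂,c₂) Φ⁻¹(a₃,c₃,b₂) R(b₃,c₄) Φ(a₄,b₄,c₅)`. -/
  hexagon_left :
    R.val.comap (M.mul.toLinearMap.rTensor H ∘ₗ assocInv H H H) =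
      M.Φ.val.comap (permCAB k H) * R.val.comap (dropB k H) *
        M.Φ⁻¹.val.comap (permACB k H) * R.val.comap (dropA k H) * M.Φ.val
  /-- `R(a,bc) = Φ⁻¹(b₁,c₁,a₁) R(a₂,c₂) Φ(b₂,a₃,c₃) R(a₄,b₃) Φ⁻¹(a₅,b₄,c₄)`. -/
  hexagon_right :
    R.val.comap (M.mul.toLinearMap.lTensor H) =
      M.Φ⁻¹.val.comap (permBCA k H) * R.val.comap (dropB k H) *
        M.Φ.val.comap (permBAC k H) * R.val.comap (dropC k H) * M.Φ⁻¹.val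
  /-- `b₁a₁ R(a₂,b₂) = R(a₁,b₁) a₂b₂`. -/
  braided_comm :
    convRight (M.mul.toLinearMap ∘ₗ (TensorProduct.comm k H H).toLinearMap) R.val.ofConv =
      convLeft R.val.ofConv M.mul.toLinearMap

/-- The coalgebra `H` admits a coquasitriangular Majid algebra structure. -/
def AdmitsCoquasitriangularMajid (k : Type*) (H : Type*) [Field k] [AddCommGroup H] [Module k H]
    [Coalgebra k H] : Prop :=
  ∃ M : MajidAlgebra k H, Nonempty (CoquasitriangularStructure M)

/-!
If the path coalgebra carries a coquasitriangular Majid algebra structure, its group-like elements,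
which are the vertices (`PathCoalgebra.exists_vertex_of_isGroupLikeElem`), are closed under the
multiplication and the antipode. On group-like elements all functionals of the structure that matter
are nonzero scalars and cancel from the axioms, so the vertices form an abelian group
(`PathCoalgebra.exists_commGroup`). The arrows from `a` to `b` are a basis of the
skew-primitive elements between `a` and `b`, modulo `b - a`
(`PathCoalgebra.eq_smul_sub_of_skewPrimitive`). Right multiplication by a vertex `z` is injective on
these spaces: by quasi-associativity, multiplication by `z⁻¹` undoes it up to a nonzero scalar and a
multiple of `b - a`. So the number of arrows from `x` to `y` depends only on `y x⁻¹`
(`PathCoalgebra.card_hom_mul`), which makes the quiver a Hopf quiver.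

Conversely, a path of a Hopf quiver of an abelian group `G` is a start vertex `g` together with
a word of arrow labels, and the comultiplication splits words. The shuffle product
`(g, u) (h, v) = (g h, u ⧢ v)` makes this a commutative Hopf algebra
(`WordBasis.admitsCoquasitriangularMajid`); commutativity of `G` is what makes the end vertex of a
shuffle the product of the end vertices. A commutative Hopf algebra is a coquasitriangular Majid
algebra with trivial `Φ` and trivial universal `R`-form
(`admitsCoquasitriangularMajid_of_commutative_hopf`).
-/

/-! ### Commutative Hopf algebras are coquasitriangular Majid algebras -/

section Trivial

variable {k H : Type*} [Field k] [AddCommGroup H] [Module k H] [Coalgebra k H]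

theorem ConvDual.ofConv_one {C : Type*} [AddCommGroup C] [Module k C] [Coalgebra k C] :
    (1 : ConvDual k C).ofConv = Coalgebra.counit := rfl

theorem ConvDual.comap_one {C D : Type*} [AddCommGroup C] [Module k C] [Coalgebra k C]
    [AddCommGroup D] [Module k D] [Coalgebra k D] {f : C →ₗ[k] D}
    (hf : Coalgebra.counit ∘ₗ f = Coalgebra.counit (R := k)) :
    (1 : ConvDual k D).comap f = 1 :=
  congrArg WithConv.toConv hf

theorem convLeft_counit {M : Type*} [AddCommGroup M] [Module k M] (f : H →ₗ[k] M) :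
    convLeft Coalgebra.counit f = f := by
  ext x
  have h := congrArg (fun t => TensorProduct.lid k M (f.lTensor k t))
    (Coalgebra.rTensor_counit_comul (R := k) x)
  rw [← LinearMap.comp_apply, LinearMap.lTensor_comp_rTensor] at h
  exact h.trans (by simp)

theorem convRight_counit {M : Type*} [AddCommGroup M] [Module k M] (f : H →ₗ[k] M) :
    convRight f Coalgebra.counit = f := by
  ext x
  have h := congrArg (fun t => TensorProduct.rid k M (f.rTensor k t))
    (Coalgebra.lTensor_counit_comul (R := k) x)
  rw [← LinearMap.comp_apply, LinearMap.rTensor_comp_lTensor] at h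
  exact h.trans (by simp)

theorem counit_map {A B C D : Type*} [AddCommGroup A] [Module k A] [Coalgebra k A]
    [AddCommGroup B] [Module k B] [Coalgebra k B] [AddCommGroup C] [Module k C] [Coalgebra k C]
    [AddCommGroup D] [Module k D] [Coalgebra k D] {f : A →ₗ[k] C} {g : B →ₗ[k] D}
    (hf : Coalgebra.counit ∘ₗ f = Coalgebra.counit (R := k))
    (hg : Coalgebra.counit ∘ₗ g = Coalgebra.counit (R := k)) :
    Coalgebra.counit ∘ₗ TensorProduct.map f g = Coalgebra.counit (R := k) := by
  refine TensorProduct.ext' fun a b => ?_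
  simp [← LinearMap.congr_fun hf a, ← LinearMap.congr_fun hg b]

theorem counit_lTensor (A : Type*) {B C : Type*} [AddCommGroup A] [Module k A] [Coalgebra k A]
    [AddCommGroup B] [Module k B] [Coalgebra k B] [AddCommGroup C] [Module k C] [Coalgebra k C]
    {f : B →ₗ[k] C} (hf : Coalgebra.counit ∘ₗ f = Coalgebra.counit (R := k)) :
    Coalgebra.counit ∘ₗ f.lTensor A = Coalgebra.counit (R := k) :=
  counit_map rfl hf

theorem counit_rTensor (A : Type*) {B C : Type*} [AddCommGroup A] [Module k A] [Coalgebra k A]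
    [AddCommGroup B] [Module k B] [Coalgebra k B] [AddCommGroup C] [Module k C] [Coalgebra k C]
    {f : B →ₗ[k] C} (hf : Coalgebra.counit ∘ₗ f = Coalgebra.counit (R := k)) :
    Coalgebra.counit ∘ₗ f.rTensor A = Coalgebra.counit (R := k) :=
  counit_map hf rfl

theorem counit_comp_comul :
    Coalgebra.counit ∘ₗ Coalgebra.comul = Coalgebra.counit (R := k) (A := H) := by
  have h : Coalgebra.counit (R := k) (A := H ⊗[k] H) =
      Coalgebra.counit ∘ₗ (TensorProduct.lid k H).toLinearMap ∘ₗ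
        (Coalgebra.counit (R := k) (A := H)).rTensor H :=
    TensorProduct.ext' fun a b => by simp [mul_comm]
  ext x
  simp [h]

theorem counit_assocInv (A B C : Type*) [AddCommGroup A] [Module k A] [Coalgebra k A]
    [AddCommGroup B] [Module k B] [Coalgebra k B] [AddCommGroup C] [Module k C] [Coalgebra k C] :
    Coalgebra.counit ∘ₗ assocInv A B C = Coalgebra.counit (R := k) :=
  TensorProduct.ext_threefold' fun a b c => by simp [assocInv, mul_assoc]

theorem counit_tensorComm (A B : Type*) [AddCommGroup A] [Module k A] [Coalgebra k A]
    [AddCommGroup B] [Module k B] [Coalgebra k B] :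
    Coalgebra.counit ∘ₗ (TensorProduct.comm k A B).toLinearMap = Coalgebra.counit (R := k) :=
  TensorProduct.ext' fun a b => by simp [mul_comm]

theorem counit_counitLeft (A C : Type*) [AddCommGroup A] [Module k A] [Coalgebra k A]
    [AddCommGroup C] [Module k C] [Coalgebra k C] :
    Coalgebra.counit ∘ₗ counitLeft A C = Coalgebra.counit (R := k) :=
  TensorProduct.ext' fun a b => by simp [counitLeft, mul_comm]

theorem counit_counitRight (C A : Type*) [AddCommGroup A] [Module k A] [Coalgebra k A]
    [AddCommGroup C] [Module k C] [Coalgebra k C] :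
    Coalgebra.counit ∘ₗ counitRight C A = Coalgebra.counit (R := k) :=
  TensorProduct.ext' fun a b => by simp [counitRight]

theorem counit_comp_comp {A B C : Type*} [AddCommGroup A] [Module k A] [Coalgebra k A]
    [AddCommGroup B] [Module k B] [Coalgebra k B] [AddCommGroup C] [Module k C] [Coalgebra k C]
    {g : B →ₗ[k] C} {f : A →ₗ[k] B} (hg : Coalgebra.counit ∘ₗ g = Coalgebra.counit (R := k))
    (hf : Coalgebra.counit ∘ₗ f = Coalgebra.counit (R := k)) :
    Coalgebra.counit ∘ₗ (g ∘ₗ f) = Coalgebra.counit (R := k) := by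
  rw [← LinearMap.comp_assoc, hg, hf]

/-- A commutative Hopf algebra, with trivial associator, trivial universal `R`-form and
`α = β = ε`. -/
theorem admitsCoquasitriangularMajid_of_commutative_hopf (mul : H ⊗[k] H →ₗc[k] H) (one : H)
    (hone : IsGroupLikeElem k one) (one_mul : ∀ a, mul (one ⊗ₜ a) = a)
    (comm : ∀ a b, mul (a ⊗ₜ b) = mul (b ⊗ₜ a))
    (assoc : ∀ a b c, mul (mul (a ⊗ₜ b) ⊗ₜ c) = mul (a ⊗ₜ mul (b ⊗ₜ c)))
    (S : H →ₗ[k] H) (counit_S : Coalgebra.counit ∘ₗ S = Coalgebra.counit (R := k) (A := H))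
    (comul_S : Coalgebra.comul ∘ₗ S =
      (TensorProduct.comm k H H).toLinearMap ∘ₗ TensorProduct.map S S ∘ₗ Coalgebra.comul)
    (S_left : mul.toLinearMap ∘ₗ S.rTensor H ∘ₗ Coalgebra.comul =
      (Coalgebra.counit (R := k) (A := H)).smulRight one)
    (S_right : mul.toLinearMap ∘ₗ S.lTensor H ∘ₗ Coalgebra.comul =
      (Coalgebra.counit (R := k) (A := H)).smulRight one) :
    AdmitsCoquasitriangularMajid k H := by
  have hm : Coalgebra.counit ∘ₗ mul.toLinearMap = Coalgebra.counit (R := k) := mul.counit_comp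
  have hid : Coalgebra.counit ∘ₗ LinearMap.id = Coalgebra.counit (R := k) (A := H) := rfl
  have hbca : Coalgebra.counit ∘ₗ permBCA k H = Coalgebra.counit (R := k) :=
    TensorProduct.ext_threefold' fun a b c => by
      simp only [permBCA, LinearMap.comp_apply, LinearEquiv.coe_coe, TensorProduct.comm_tmul,
        TensorProduct.assoc_tmul, TensorProduct.counit_tmul, smul_eq_mul]
      ring
  have hbac : Coalgebra.counit ∘ₗ permBAC k H = Coalgebra.counit (R := k) :=
    TensorProduct.ext_threefold' fun a b c => by
      change Coalgebra.counit (R := k) (b ⊗ₜ[k] (a ⊗ₜ[k] c)) = _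
      simp only [TensorProduct.counit_tmul, smul_eq_mul]
      ring
  have hb : mul.toLinearMap ∘ₗ (TensorProduct.comm k H H).toLinearMap = mul.toLinearMap :=
    TensorProduct.ext' fun a b => comm b a
  have h₁ : Coalgebra.counit ∘ₗ (mul.toLinearMap.lTensor H).lTensor H =
      Coalgebra.counit (R := k) := counit_lTensor _ (counit_lTensor _ hm)
  have h₂ : Coalgebra.counit ∘ₗ mul.toLinearMap.rTensor (H ⊗[k] H) ∘ₗ assocInv H H (H ⊗[k] H) =
      Coalgebra.counit (R := k) :=
    counit_comp_comp (counit_rTensor _ hm) (counit_assocInv H H (H ⊗[k] H))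
  have h₃ : Coalgebra.counit ∘ₗ mul.toLinearMap.rTensor H ∘ₗ assocInv H H H =
      Coalgebra.counit (R := k) := counit_comp_comp (counit_rTensor _ hm) (counit_assocInv H H H)
  have hcab : Coalgebra.counit ∘ₗ permCAB k H = Coalgebra.counit (R := k) :=
    counit_comp_comp (counit_tensorComm _ _) (counit_assocInv H H H)
  have hacb : Coalgebra.counit ∘ₗ permACB k H = Coalgebra.counit (R := k) :=
    counit_lTensor H (counit_tensorComm H H)
  have hA : Coalgebra.counit ∘ₗ dropA k H = Coalgebra.counit (R := k) :=
    counit_counitLeft H (H ⊗[k] H)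
  have hB : Coalgebra.counit ∘ₗ dropB k H = Coalgebra.counit (R := k) :=
    counit_lTensor H (counit_counitLeft H H)
  have hC : Coalgebra.counit ∘ₗ dropC k H = Coalgebra.counit (R := k) :=
    counit_lTensor H (counit_counitRight H H)
  let M : MajidAlgebra k H :=
    { mul := mul
      one := one
      isGroupLikeElem_one := hone
      one_mul := one_mul
      mul_one := fun a => by rw [comm, one_mul]
      Φ := 1
      quasi_assoc := by
        rw [Units.val_one, ConvDual.ofConv_one, convLeft_counit, convRight_counit]
        exact TensorProduct.ext_threefold' fun a b c => (assoc a b c).symm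
      pentagon := by
        rw [Units.val_one, ConvDual.comap_one h₁, ConvDual.comap_one h₂,
          ConvDual.comap_one (counit_counitLeft H (H ⊗[k] (H ⊗[k] H))),
          ConvDual.comap_one (counit_lTensor H h₃),
          ConvDual.comap_one (counit_lTensor H (counit_lTensor H (counit_counitRight H H))),
          _root_.one_mul, _root_.one_mul]
      Φ_one := fun a b => by
        change Coalgebra.counit (R := k) (a ⊗ₜ[k] (one ⊗ₜ[k] b)) = _
        simp [hone.counit_eq_one, mul_comm]
      S := S
      α := Coalgebra.counit
      β := Coalgebra.counit
      counit_S := counit_S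
      comul_S := comul_S
      S_α := by rw [convLeft_counit]; exact S_left
      β_S := by rw [convLeft_counit]; exact S_right
      Φ_S := by
        rw [Units.val_one, ConvDual.ofConv_one, convRight_counit, convRight_counit,
          ← LinearMap.comp_assoc, counit_map hid (counit_map counit_S hid), ← LinearMap.comp_assoc,
          counit_lTensor _ counit_comp_comul, counit_comp_comul]
      Φ_inv_S := by
        rw [inv_one, Units.val_one, ConvDual.ofConv_one, convRight_counit, convRight_counit,
          ← LinearMap.comp_assoc, counit_map counit_S (counit_map hid counit_S),
          ← LinearMap.comp_assoc,
          counit_lTensor _ counit_comp_comul, counit_comp_comul] }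
  refine ⟨M, ⟨{ R := 1, hexagon_left := ?_, hexagon_right := ?_, braided_comm := ?_ }⟩⟩
  · rw [inv_one, Units.val_one, Units.val_one, ConvDual.comap_one h₃, ConvDual.comap_one hcab,
      ConvDual.comap_one hB, ConvDual.comap_one hacb, ConvDual.comap_one hA]
    simp only [_root_.one_mul]
  · rw [inv_one, Units.val_one, Units.val_one, ConvDual.comap_one (counit_lTensor H hm),
      ConvDual.comap_one hbca, ConvDual.comap_one hB, ConvDual.comap_one hbac,
      ConvDual.comap_one hC]
    simp only [_root_.one_mul]
  · rw [Units.val_one, ConvDual.ofConv_one, convLeft_counit, convRight_counit]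
    exact hb

end Trivial

/-! ### The shuffle product

A basis vector `B (g, w)` stands for the path that starts at `g` and whose arrows have the labels
`w`, the last arrow first, so that `List.drop` gives initial parts of the path. -/

namespace WordBasis

noncomputable section

variable {k H G X : Type*} [Field k] [AddCommGroup H] [Module k H]
  (B : Module.Basis (G × List X) k H)

/-- The linear map `(g, w) ↦ (g, x w)`. -/
def cons (x : X) : H →ₗ[k] H := B.constr k fun p => B (p.1, x :: p.2)

/-- The linear map `(g, w) ↦ (g, w x)`. -/
def snoc (x : X) : H →ₗ[k] H := B.constr k fun p => B (p.1, p.2 ++ [x])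

/-- The linear map that reverses words. -/
def rev : H →ₗ[k] H := B.constr k fun p => B (p.1, p.2.reverse)

/-- The sum of all shuffles of two words, as words based at `g`. -/
def shuffle (g : G) : List X → List X → H
  | [], v => B (g, v)
  | x :: u, [] => B (g, x :: u)
  | x :: u, y :: v => cons B x (shuffle g u (y :: v)) + cons B y (shuffle g (x :: u) v)

@[simp]
theorem cons_basis (x : X) (g : G) (w : List X) : cons B x (B (g, w)) = B (g, x :: w) :=
  B.constr_basis k _ _

@[simp]
theorem snoc_basis (x : X) (g : G) (w : List X) : snoc B x (B (g, w)) = B (g, w ++ [x]) :=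
  B.constr_basis k _ _

@[simp]
theorem rev_basis (g : G) (w : List X) : rev B (B (g, w)) = B (g, w.reverse) :=
  B.constr_basis k _ _

@[simp]
theorem shuffle_nil_left (g : G) (v : List X) : shuffle B g [] v = B (g, v) := by
  cases v <;> simp [shuffle]

@[simp]
theorem shuffle_nil_right (g : G) (u : List X) : shuffle B g u [] = B (g, u) := by
  cases u <;> simp [shuffle]

theorem shuffle_cons_cons (g : G) (x y : X) (u v : List X) :
    shuffle B g (x :: u) (y :: v) =
      cons B x (shuffle B g u (y :: v)) + cons B y (shuffle B g (x :: u) v) := by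
  simp [shuffle]

theorem shuffle_comm (g : G) (u v : List X) : shuffle B g u v = shuffle B g v u := by
  induction u generalizing v with
  | nil => simp
  | cons x u ihu =>
    induction v with
    | nil => simp
    | cons y v ihv => rw [shuffle_cons_cons, shuffle_cons_cons, ihu, ihv, add_comm]

theorem shuffle_snoc_snoc (g : G) (x y : X) (u v : List X) :
    shuffle B g (u ++ [x]) (v ++ [y]) =
      snoc B x (shuffle B g u (v ++ [y])) + snoc B y (shuffle B g (u ++ [x]) v) := by
  have hc : ∀ z z' a, snoc B z (cons B z' a) = cons B z' (snoc B z a) := fun z z' a =>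
    LinearMap.congr_fun (f := snoc B z ∘ₗ cons B z') (g := cons B z' ∘ₗ snoc B z)
      (B.ext fun ⟨h, w⟩ => by simp) a
  induction u generalizing v with
  | nil =>
    induction v with
    | nil => simp [shuffle_cons_cons, add_comm]
    | cons b v ihv =>
      simp only [List.nil_append, List.cons_append, shuffle_nil_left] at *
      rw [shuffle_cons_cons, ihv, shuffle_cons_cons]
      simp [hc]
      abel
  | cons a u ihu =>
    induction v with
    | nil =>
      have h := ihu []
      simp only [List.nil_append, List.cons_append, shuffle_nil_right] at *
      rw [shuffle_cons_cons, h, shuffle_cons_cons]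
      simp [hc]
      abel
    | cons b v ihv =>
      have h := ihu (b :: v)
      simp only [List.cons_append] at *
      rw [shuffle_cons_cons, h, ihv, shuffle_cons_cons, shuffle_cons_cons]
      simp only [map_add, hc]
      abel

theorem rev_shuffle (g : G) (u v : List X) :
    rev B (shuffle B g u v) = shuffle B g u.reverse v.reverse := by
  have hc : ∀ z a, rev B (cons B z a) = snoc B z (rev B a) := fun z a =>
    LinearMap.congr_fun (f := rev B ∘ₗ cons B z) (g := snoc B z ∘ₗ rev B)
      (B.ext fun ⟨h, w⟩ => by simp) a
  induction u generalizing v with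
  | nil => simp
  | cons x u ihu =>
    induction v with
    | nil => simp
    | cons y v ihv =>
      rw [shuffle_cons_cons, map_add, hc, hc, ihu, ihv, List.reverse_cons, List.reverse_cons,
        shuffle_snoc_snoc]

/-- The sum telescopes: by the recursion for shuffles, the terms that start with a letter of the
reversed initial segment cancel those that start with a letter of the remaining word, except for the
words that start with `x`. -/
theorem sum_shuffle_reverse_take_cons (g : G) (x : X) (r w : List X) :
    ∑ i ∈ Finset.range (w.length + 1),
      (-1 : k) ^ i • shuffle B g ((w.take i).reverse ++ x :: r) (w.drop i) =
        cons B x (shuffle B g r w) := by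
  induction w generalizing x r with
  | nil => simp
  | cons y w ih =>
    have h := ih y (x :: r)
    rw [List.length_cons, Finset.sum_range_succ']
    simp only [List.take_succ_cons, List.reverse_cons, List.append_assoc, List.singleton_append,
      List.drop_succ_cons, pow_succ, mul_neg, mul_one, neg_smul, Finset.sum_neg_distrib, h]
    simp [shuffle_cons_cons]

theorem sum_shuffle_reverse_take (g : G) {w : List X} (hw : w ≠ []) :
    ∑ i ∈ Finset.range (w.length + 1),
      (-1 : k) ^ i • shuffle B g (w.take i).reverse (w.drop i) = 0 := by
  cases w with
  | nil => exact absurd rfl hw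
  | cons y w =>
    have h := sum_shuffle_reverse_take_cons B g y [] w
    rw [List.length_cons, Finset.sum_range_succ']
    simp only [List.take_succ_cons, List.reverse_cons,
      List.drop_succ_cons, pow_succ, mul_neg, mul_one, neg_smul, Finset.sum_neg_distrib, h]
    simp

theorem sum_shuffle_take_reverse (g : G) {w : List X} (hw : w ≠ []) :
    ∑ i ∈ Finset.range (w.length + 1),
      (-1 : k) ^ i • shuffle B g (w.take i) (w.drop i).reverse = 0 := by
  have h := congrArg (rev B) (sum_shuffle_reverse_take B g hw)
  simpa [rev_shuffle] using h

variable [CommGroup G]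

/-- The linear map `(g, w) ↦ (c g, w)`. -/
def translate (c : G) : H →ₗ[k] H := B.constr k fun p => B (c * p.1, p.2)

/-- The bilinear product `(g, u) (h, v) = (g h, u ⧢ v)`. -/
def mul : H →ₗ[k] H →ₗ[k] H :=
  B.constr k fun p => B.constr k fun q => shuffle B (p.1 * q.1) p.2 q.2

@[simp]
theorem translate_basis (c g : G) (w : List X) : translate B c (B (g, w)) = B (c * g, w) :=
  B.constr_basis k _ _

theorem mul_basis (g h : G) (u v : List X) :
    mul B (B (g, u)) (B (h, v)) = shuffle B (g * h) u v := by
  rw [mul, B.constr_basis, B.constr_basis]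

theorem mul_comm (a b : H) : mul B a b = mul B b a := by
  have h : mul B = (mul B).flip :=
    B.ext fun ⟨g, u⟩ => B.ext fun ⟨h, v⟩ => by
      rw [LinearMap.flip_apply, mul_basis,
        mul_basis, shuffle_comm, _root_.mul_comm]
  exact LinearMap.congr_fun₂ h a b

theorem translate_shuffle (c g : G) (u v : List X) :
    translate B c (shuffle B g u v) = shuffle B (c * g) u v := by
  have hc : ∀ x a, translate B c (cons B x a) = cons B x (translate B c a) := fun x a =>
    LinearMap.congr_fun (f := translate B c ∘ₗ cons B x) (g := cons B x ∘ₗ translate B c)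
      (B.ext fun ⟨h, w⟩ => by simp) a
  induction u generalizing v with
  | nil => simp
  | cons x u ihu =>
    induction v with
    | nil => simp
    | cons y v ihv => rw [shuffle_cons_cons, shuffle_cons_cons, map_add, hc, hc, ihu, ihv]

theorem mul_basis_nil (g : G) (a : H) : mul B (B (g, [])) a = translate B g a :=
  LinearMap.congr_fun (B.ext fun ⟨h, w⟩ => by
    rw [mul_basis, shuffle_nil_left, translate_basis]) a

theorem one_mul (a : H) : mul B (B (1, [])) a = a := by
  rw [mul_basis_nil]
  exact LinearMap.congr_fun (g := LinearMap.id)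
    (B.ext fun ⟨g, w⟩ => by rw [translate_basis]; simp) a

theorem mul_cons_cons (x y : X) (a b : H) :
    mul B (cons B x a) (cons B y b) =
      cons B x (mul B a (cons B y b)) + cons B y (mul B (cons B x a) b) := by
  have h : (mul B).compl₁₂ (cons B x) (cons B y) =
      ((mul B).compl₂ (cons B y)).compr₂ (cons B x) +
        ((mul B).compl₁₂ (cons B x) LinearMap.id).compr₂ (cons B y) :=
    B.ext fun ⟨g₁, u⟩ => B.ext fun ⟨g₂, v⟩ => by
      simp [mul_basis, shuffle_cons_cons]
  exact LinearMap.congr_fun₂ h a b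

theorem mul_basis_nil_cons (g : G) (y : X) (b : H) :
    mul B (B (g, [])) (cons B y b) = cons B y (mul B (B (g, [])) b) :=
  LinearMap.congr_fun (f := mul B (B (g, [])) ∘ₗ cons B y) (g := cons B y ∘ₗ mul B (B (g, [])))
    (B.ext fun ⟨h, w⟩ => by simp [mul_basis]) b

theorem mul_basis_nil_mul (g : G) (a b : H) :
    mul B (mul B (B (g, [])) a) b = mul B (B (g, [])) (mul B a b) := by
  have h : mul B ∘ₗ mul B (B (g, [])) = (mul B).compr₂ (mul B (B (g, []))) :=
    B.ext fun ⟨g₁, u⟩ => B.ext fun ⟨g₂, v⟩ => by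
      simp [mul_basis, mul_basis_nil, translate_shuffle, mul_assoc]
  exact LinearMap.congr_fun₂ h a b

theorem mul_assoc_basis (g h l : G) (u v w : List X) :
    mul B (mul B (B (g, u)) (B (h, v))) (B (l, w)) =
      mul B (B (g, u)) (mul B (B (h, v)) (B (l, w))) := by
  induction u generalizing v w with
  | nil => rw [mul_basis_nil_mul]
  | cons x u ihu =>
    induction v generalizing w with
    | nil =>
      rw [mul_comm B (B (g, x :: u)), mul_basis_nil_mul, mul_comm B (B (g, x :: u)) (mul _ _ _),
        mul_basis_nil_mul, mul_comm B (B (g, x :: u))]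
    | cons y v ihv =>
      induction w with
      | nil =>
        rw [mul_comm B _ (B (l, [])), mul_comm B _ (B (l, [])), mul_comm B _ (mul B (B (l, [])) _),
          mul_basis_nil_mul, mul_comm B (B (g, x :: u))]
      | cons z w ihw =>
        simp only [← cons_basis] at *
        -- expand all products by the shuffle recursion and use associativity for shorter words
        rw [mul_cons_cons B x y, mul_cons_cons B y z, map_add, map_add, LinearMap.add_apply,
          mul_cons_cons, mul_cons_cons, mul_cons_cons, mul_cons_cons]
        have h₁ := ihu (y :: v) (z :: w)
        have h₂ := ihv (z :: w)
        simp only [← cons_basis] at h₁ h₂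
        rw [h₁, h₂, ← ihw, mul_cons_cons B y z, mul_cons_cons B x y]
        simp only [map_add, LinearMap.add_apply]
        abel

theorem mul_assoc (a b c : H) : mul B (mul B a b) c = mul B a (mul B b c) := by
  have h : (mul B).compr₂ (mul B) = (LinearMap.llcomp k H H H).compl₁₂ (mul B) (mul B) :=
    B.ext fun ⟨g, u⟩ => B.ext fun ⟨h, v⟩ => B.ext fun ⟨l, w⟩ => by
      simpa using mul_assoc_basis B g h l u v w
  exact LinearMap.congr_fun (LinearMap.congr_fun₂ h a b) c

end

end WordBasis

/-! ### Compatibility of shuffles with splitting words -/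

namespace WordBasis

noncomputable section

variable {k H G X : Type*} [Field k] [AddCommGroup H] [Module k H] [CommGroup G]
  (deg : X → G) (B : Module.Basis (G × List X) k H)

/-- The linear map `(g, w) ↦ (deg w g, ∅) ⊗ (g, w)`, the coaction of the group algebra that records
the end vertex of a path. -/
def endCoaction : H →ₗ[k] H ⊗[k] H :=
  B.constr k fun p => B ((p.2.map deg).prod * p.1, []) ⊗ₜ B p

@[simp]
theorem endCoaction_basis (g : G) (w : List X) :
    endCoaction deg B (B (g, w)) = B ((w.map deg).prod * g, []) ⊗ₜ B (g, w) :=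
  B.constr_basis k _ _

theorem endCoaction_shuffle (g : G) (u v : List X) :
    endCoaction deg B (shuffle B g u v) =
      B ((u.map deg).prod * ((v.map deg).prod * g), []) ⊗ₜ shuffle B g u v := by
  have hc : ∀ x a, endCoaction deg B (cons B x a) =
      TensorProduct.map (translate B (deg x)) (cons B x) (endCoaction deg B a) := fun x a =>
    LinearMap.congr_fun (f := endCoaction deg B ∘ₗ cons B x)
      (g := TensorProduct.map (translate B (deg x)) (cons B x) ∘ₗ endCoaction deg B)
      (B.ext fun ⟨h, w⟩ => by simp [_root_.mul_assoc]) a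
  induction u generalizing v with
  | nil => simp
  | cons x u ihu =>
    induction v with
    | nil => simp
    | cons y v ihv =>
      rw [shuffle_cons_cons, map_add, hc, hc, ihu, ihv, tmul_add]
      simp [_root_.mul_assoc, mul_left_comm]

/-- The product of the tensor square. -/
def mulTensor : H ⊗[k] H →ₗ[k] H ⊗[k] H →ₗ[k] H ⊗[k] H := TensorProduct.map₂ (mul B) (mul B)

@[simp]
theorem mulTensor_tmul (a b c d : H) :
    mulTensor B (a ⊗ₜ b) (c ⊗ₜ d) = mul B a c ⊗ₜ mul B b d := rfl

theorem mulTensor_comm (s t : H ⊗[k] H) : mulTensor B s t = mulTensor B t s := by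
  induction s with
  | zero => simp
  | add s₁ s₂ h₁ h₂ => simp [h₁, h₂]
  | tmul a b =>
    induction t with
    | zero => simp
    | add t₁ t₂ h₁ h₂ => simp [h₁, h₂]
    | tmul c d => rw [mulTensor_tmul, mulTensor_tmul, mul_comm B a, mul_comm B b]

theorem mulTensor_cons_cons (x y : X) (s t : H ⊗[k] H) :
    mulTensor B ((cons B x).rTensor H s) ((cons B y).rTensor H t) =
      (cons B x).rTensor H (mulTensor B s ((cons B y).rTensor H t)) +
        (cons B y).rTensor H (mulTensor B ((cons B x).rTensor H s) t) := by
  induction s with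
  | zero => simp
  | add s₁ s₂ h₁ h₂ => simp only [map_add, LinearMap.add_apply, h₁, h₂]; abel
  | tmul a b =>
    induction t with
    | zero => simp
    | add t₁ t₂ h₁ h₂ => simp only [map_add, h₁, h₂]; abel
    | tmul c d => simp [mul_cons_cons, add_tmul]

theorem mulTensor_basis_nil_cons (g : G) (y : X) (a : H) (t : H ⊗[k] H) :
    mulTensor B (B (g, []) ⊗ₜ a) ((cons B y).rTensor H t) =
      (cons B y).rTensor H (mulTensor B (B (g, []) ⊗ₜ a) t) := by
  induction t with
  | zero => simp
  | add t₁ t₂ h₁ h₂ => simp only [map_add, h₁, h₂]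
  | tmul c d => simp [mul_basis_nil_cons]

/-- The antipode `(g, w) ↦ (-1)^|w| ((deg w g)⁻¹, reverse of w)`. -/
def antipode : H →ₗ[k] H :=
  B.constr k fun p => (-1 : k) ^ p.2.length • B (((p.2.map deg).prod * p.1)⁻¹, p.2.reverse)

@[simp]
theorem antipode_basis (g : G) (w : List X) : antipode deg B (B (g, w)) =
    (-1 : k) ^ w.length • B (((w.map deg).prod * g)⁻¹, w.reverse) :=
  B.constr_basis k _ _

variable [Coalgebra k H] {deg B}

section

variable (hΔ : ∀ g w, Coalgebra.comul (R := k) (B (g, w)) = ∑ i ∈ Finset.range (w.length + 1),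
    B (((w.drop i).map deg).prod * g, w.take i) ⊗ₜ[k] B (g, w.drop i))

include hΔ

theorem comul_basis_nil (g : G) :
    Coalgebra.comul (R := k) (B (g, [])) = B (g, []) ⊗ₜ[k] B (g, []) := by
  simp [hΔ]

theorem comul_cons (x : X) (a : H) : Coalgebra.comul (R := k) (cons B x a) =
    endCoaction deg B (cons B x a) + (cons B x).rTensor H (Coalgebra.comul a) :=
  LinearMap.congr_fun (f := Coalgebra.comul ∘ₗ cons B x)
    (g := endCoaction deg B ∘ₗ cons B x + (cons B x).rTensor H ∘ₗ Coalgebra.comul)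
    (B.ext fun ⟨h, w⟩ => by
      rw [LinearMap.comp_apply, cons_basis, hΔ, List.length_cons, Finset.sum_range_succ', add_comm]
      simp [hΔ]) a

/-- Induction on the total length: `comul_cons` and the shuffle recursion for `mulTensor` reduce
both sides to shorter words, and the remaining terms agree by `endCoaction_shuffle`. -/
theorem comul_mul_basis (g h : G) (u v : List X) :
    Coalgebra.comul (R := k) (mul B (B (g, u)) (B (h, v))) =
      mulTensor B (Coalgebra.comul (B (g, u))) (Coalgebra.comul (B (h, v))) := by
  have hnil : ∀ (g h : G) (v : List X), Coalgebra.comul (R := k) (mul B (B (g, [])) (B (h, v))) =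
      mulTensor B (Coalgebra.comul (B (g, []))) (Coalgebra.comul (B (h, v))) := fun g h v => by
    rw [comul_basis_nil hΔ, hΔ h, mul_basis, shuffle_nil_left, hΔ]
    simp [mul_basis, mul_left_comm]
  induction u generalizing v with
  | nil => exact hnil g h v
  | cons x u ihu =>
    induction v with
    | nil => rw [mul_comm, hnil, mulTensor_comm]
    | cons y v ihv =>
      have h₁ : endCoaction deg B (cons B x (mul B (B (g, u)) (B (h, y :: v)))) +
          endCoaction deg B (cons B y (mul B (B (g, x :: u)) (B (h, v)))) =
          mulTensor B (endCoaction deg B (B (g, x :: u))) (endCoaction deg B (B (h, y :: v))) := by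
        rw [← map_add, mul_basis, mul_basis, ← shuffle_cons_cons, endCoaction_shuffle]
        simp only [endCoaction_basis, mulTensor_tmul, mul_basis, shuffle_nil_left]
        congr 3
        simp only [_root_.mul_assoc, mul_left_comm g]
      have h₂ := comul_cons hΔ x (B (g, u))
      have h₃ := comul_cons hΔ y (B (h, v))
      rw [← cons_basis, ← cons_basis, mul_cons_cons, map_add, comul_cons hΔ, comul_cons hΔ,
        cons_basis, cons_basis, ihu, ihv, add_add_add_comm, h₁]
      rw [cons_basis] at h₂ h₃
      rw [h₂, h₃]
      simp only [map_add, LinearMap.add_apply, mulTensor_cons_cons]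
      simp only [endCoaction_basis, mulTensor_basis_nil_cons]
      rw [mulTensor_comm B ((cons B x).rTensor H _) (_ ⊗ₜ _), mulTensor_basis_nil_cons,
        mulTensor_comm B (_ ⊗ₜ _) (Coalgebra.comul (B (g, u)))]
      abel

theorem comul_antipode :
    Coalgebra.comul ∘ₗ antipode deg B = (TensorProduct.comm k H H).toLinearMap ∘ₗ
      TensorProduct.map (antipode deg B) (antipode deg B) ∘ₗ Coalgebra.comul :=
  B.ext fun ⟨g, w⟩ => by
    simp only [LinearMap.comp_apply, antipode_basis, map_smul, hΔ, map_sum, TensorProduct.map_tmul,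
      LinearEquiv.coe_coe, TensorProduct.comm_tmul]
    rw [List.length_reverse, Finset.smul_sum, ← Finset.sum_range_reflect]
    refine Finset.sum_congr rfl fun i hi => ?_
    have hi : i ≤ w.length := Nat.lt_succ_iff.1 (Finset.mem_range.1 hi)
    have h₁ : w.length + 1 - 1 - i = w.length - i := rfl
    have h₂ : w.length - (w.length - i) = i := Nat.sub_sub_self hi
    have h₃ : (w.map deg).prod * g =
        ((w.take i).map deg).prod * (((w.drop i).map deg).prod * g) := by
      rw [← _root_.mul_assoc, ← List.prod_append, ← List.map_append, List.take_append_drop]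
    rw [h₁, List.take_reverse, List.drop_reverse, h₂, ← List.prod_reverse, List.map_reverse,
      List.reverse_reverse, smul_tmul_smul, ← pow_add]
    simp [h₃, Nat.sub_add_cancel hi, hi]

theorem mul_antipode_left : TensorProduct.lift (mul B) ∘ₗ (antipode deg B).rTensor H ∘ₗ
    Coalgebra.comul =
      (B.constr k fun p => if p.2 = [] then (1 : k) else 0).smulRight (B (1, [])) :=
  B.ext fun ⟨g, w⟩ => by
    simp only [LinearMap.comp_apply, hΔ, map_sum, LinearMap.rTensor_tmul, antipode_basis,
      TensorProduct.lift.tmul, map_smul, LinearMap.smul_apply, mul_basis,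
      LinearMap.smulRight_apply, B.constr_basis]
    have h : ∀ i, (((w.take i).map deg).prod * (((w.drop i).map deg).prod * g))⁻¹ * g =
        ((w.map deg).prod)⁻¹ := fun i => by
      rw [← _root_.mul_assoc, ← List.prod_append, ← List.map_append, List.take_append_drop]
      simp
    simp only [h]
    split_ifs with hw
    · simp [hw]
    · rw [zero_smul, ← sum_shuffle_reverse_take B ((w.map deg).prod)⁻¹ hw]
      refine Finset.sum_congr rfl fun i hi => ?_
      rw [List.length_take_of_le (Nat.lt_succ_iff.1 (Finset.mem_range.1 hi))]

/-- The alternating sum is the word reversal of the one for the left antipode identity. -/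
theorem mul_antipode_right : TensorProduct.lift (mul B) ∘ₗ (antipode deg B).lTensor H ∘ₗ
    Coalgebra.comul =
      (B.constr k fun p => if p.2 = [] then (1 : k) else 0).smulRight (B (1, [])) :=
  B.ext fun ⟨g, w⟩ => by
    simp only [LinearMap.comp_apply, hΔ, map_sum, LinearMap.lTensor_tmul, antipode_basis,
      TensorProduct.lift.tmul, map_smul, mul_basis, mul_inv_cancel,
      LinearMap.smulRight_apply, B.constr_basis]
    split_ifs with hw
    · simp [hw]
    · rw [zero_smul, ← smul_zero ((-1 : k) ^ w.length), ← sum_shuffle_take_reverse B 1 hw,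
        Finset.smul_sum]
      refine Finset.sum_congr rfl fun i hi => ?_
      have hi : i ≤ w.length := Nat.lt_succ_iff.1 (Finset.mem_range.1 hi)
      rw [List.length_drop, smul_smul]
      congr 1
      rw [← pow_add, ← Nat.sub_add_cancel hi, _root_.add_assoc, pow_add _ _ (i + i),
        Even.neg_one_pow ⟨i, rfl⟩]
      simp

end

/-- A coalgebra with a basis of words based at the elements of an abelian group, on which the
comultiplication splits words, is a commutative Hopf algebra for the shuffle product. -/
theorem admitsCoquasitriangularMajid
    (hΔ : ∀ g w, Coalgebra.comul (R := k) (B (g, w)) = ∑ i ∈ Finset.range (w.length + 1),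
      B (((w.drop i).map deg).prod * g, w.take i) ⊗ₜ[k] B (g, w.drop i))
    (hε : ∀ g w, Coalgebra.counit (R := k) (B (g, w)) = if w = [] then 1 else 0) :
    AdmitsCoquasitriangularMajid k H := by
  have hε' : (B.constr k fun p => if p.2 = [] then (1 : k) else 0) = Coalgebra.counit :=
    B.ext fun ⟨g, w⟩ => by rw [B.constr_basis, hε]
  have hcons : ∀ x a, Coalgebra.counit (R := k) (cons B x a) = 0 := fun x a =>
    LinearMap.congr_fun (f := Coalgebra.counit ∘ₗ cons B x) (g := 0)
      (B.ext fun ⟨h, w⟩ => by simp [hε]) a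
  have hmul : ∀ s t : H ⊗[k] H,
      TensorProduct.map (TensorProduct.lift (mul B)) (TensorProduct.lift (mul B))
        (AlgebraTensorModule.tensorTensorTensorComm k k k k H H H H (s ⊗ₜ t)) =
      mulTensor B s t := fun s t => by
    induction s with
    | zero => simp
    | add s₁ s₂ h₁ h₂ => simp only [add_tmul, map_add, LinearMap.add_apply, h₁, h₂]
    | tmul a b =>
      induction t with
      | zero => simp
      | add t₁ t₂ h₁ h₂ => simp only [tmul_add, map_add, h₁, h₂]
      | tmul c d => simp
  let m : H ⊗[k] H →ₗc[k] H :=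
    { toLinearMap := TensorProduct.lift (mul B)
      counit_comp := TensorProduct.ext <| B.ext fun ⟨g, u⟩ => B.ext fun ⟨h, v⟩ => by
        cases u <;> cases v <;> simp [mul_basis, shuffle_cons_cons, hcons, hε]
      map_comp_comul := TensorProduct.ext <| B.ext fun ⟨g, u⟩ => B.ext fun ⟨h, v⟩ => by
        simp [hmul, comul_mul_basis hΔ] }
  refine admitsCoquasitriangularMajid_of_commutative_hopf m (B (1, []))
    ⟨by simp [hε], comul_basis_nil hΔ 1⟩ (one_mul B) (mul_comm B) (mul_assoc B) (antipode deg B)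
    (B.ext fun ⟨g, w⟩ => ?_) (comul_antipode hΔ) ?_ ?_
  · by_cases hw : w = [] <;> simp [hε, hw]
  · rw [← hε']
    exact mul_antipode_left hΔ
  · rw [← hε']
    exact mul_antipode_right hΔ

end

end WordBasis

/-! ### Paths of a Hopf quiver as words -/

namespace PathCoalgebra

section Words

variable {V : Type u} [Quiver.{w} V] {G : Type*} [CommGroup G] {N : G → ℕ} (φ : V ≃ G)
  (ψ : ∀ x y : V, (x ⟶ y) ≃ Fin (N (φ y * (φ x)⁻¹)))

/-- The word of a path in a quiver with vertex set `G` and `N c` arrows from `x` to `c x`: each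
arrow `x ⟶ c x` is read as the pair of `c` and its number, the last arrow first. -/
def word {a : V} : {b : V} → Quiver.Path a b → List (Σ c : G, Fin (N c))
  | _, .nil => []
  | _, .cons (b := b) (c := c) p e => ⟨φ c * (φ b)⁻¹, ψ b c e⟩ :: word p

theorem prod_word {a b : V} (p : Quiver.Path a b) :
    ((word φ ψ p).map Sigma.fst).prod * φ a = φ b := by
  induction p with
  | nil => simp [word]
  | cons p e ih => simp [word, mul_assoc, ih]

theorem length_word {a b : V} (p : Quiver.Path a b) : (word φ ψ p).length = p.length := by
  induction p with
  | nil => rfl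
  | cons p e ih => simp [word, ih]

theorem word_injective {a b b' : V} (p : Quiver.Path a b) (q : Quiver.Path a b')
    (h : word φ ψ p = word φ ψ q) :
    (⟨b, p⟩ : Σ b, Quiver.Path a b) = ⟨b', q⟩ := by
  induction p generalizing b' with
  | nil => cases q with
    | nil => rfl
    | cons q e => simp [word] at h
  | @cons b c p e ih => cases q with
    | nil => simp [word] at h
    | cons q e' =>
      rw [word, word, List.cons.injEq, Sigma.mk.injEq] at h
      obtain ⟨⟨h₁, h₂⟩, h₃⟩ := h
      cases ih q h₃
      obtain rfl : c = b' := φ.injective (mul_right_cancel h₁)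
      rw [(ψ b c).injective (eq_of_heq h₂)]

theorem word_surjective (a : V) (l : List (Σ c : G, Fin (N c))) :
    ∃ (b : V) (p : Quiver.Path a b), word φ ψ p = l := by
  induction l with
  | nil => exact ⟨a, .nil, rfl⟩
  | cons x l ih =>
    obtain ⟨b, p, rfl⟩ := ih
    obtain ⟨c₀, n⟩ := x
    obtain ⟨c, rfl⟩ : ∃ c, φ c * (φ b)⁻¹ = c₀ := ⟨φ.symm (c₀ * φ b), by simp⟩
    exact ⟨c, p.cons ((ψ b c).symm n), by simp [word]⟩

theorem bijective_start_word : Function.Bijective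
    fun p : PathIndex V => (φ p.1, word φ ψ p.2.2) := by
  constructor
  · rintro ⟨a, b, p⟩ ⟨a', b', q⟩ h
    obtain ⟨h₁, h₂⟩ := Prod.ext_iff.1 h
    obtain rfl : a = a' := φ.injective h₁
    exact congrArg (Sigma.mk a) (word_injective φ ψ p q h₂)
  · rintro ⟨g, l⟩
    obtain ⟨b, p, rfl⟩ := word_surjective φ ψ (φ.symm g) l
    exact ⟨⟨_, b, p⟩, by simp⟩

theorem map_word_splits {a b : V} (p : Quiver.Path a b) :
    (splits p).map (fun s => ((φ s.1, word φ ψ s.2.1), (φ a, word φ ψ s.2.2))) =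
      (List.range ((word φ ψ p).length + 1)).map fun i =>
        (((((word φ ψ p).drop i).map Sigma.fst).prod * φ a, (word φ ψ p).take i),
          (φ a, (word φ ψ p).drop i)) := by
  induction p with
  | nil => simp [splits, word]
  | @cons b c p e ih =>
    rw [List.range_succ_eq_map, splits, List.map_cons, List.map_cons, List.map_map, List.map_map]
    refine congrArg₂ _ ?_ ?_
    · simp only [List.drop_zero, List.take_zero, prod_word]
      rfl
    · have h := congrArg (List.map fun t : (G × List (Σ c : G, Fin (N c))) × _ =>
        ((t.1.1, (⟨φ c * (φ b)⁻¹, ψ b c e⟩ : Σ c : G, Fin (N c)) :: t.1.2), t.2)) ih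
      rw [List.map_map, List.map_map] at h
      exact h

variable (k : Type v) [Field k]

/-- The basis of the path coalgebra that is indexed by a start vertex and a word. -/
noncomputable def wordBasis :
    Module.Basis (G × List (Σ c : G, Fin (N c))) k (PathCoalgebra k V) :=
  (pathBasis k).reindex (Equiv.ofBijective _ (bijective_start_word φ ψ))

theorem wordBasis_word {a b : V} (p : Quiver.Path a b) :
    wordBasis φ ψ k (φ a, word φ ψ p) = ofPath k p := by
  rw [wordBasis, Module.Basis.reindex_apply, ofPath]
  exact congrArg _ ((Equiv.ofBijective _ (bijective_start_word φ ψ)).symm_apply_apply ⟨a, b, p⟩)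

include φ ψ in
theorem admitsCoquasitriangularMajid_of_hopfQuiver :
    AdmitsCoquasitriangularMajid k (PathCoalgebra k V) := by
  refine WordBasis.admitsCoquasitriangularMajid (deg := Sigma.fst) (B := wordBasis φ ψ k) ?_ ?_
  · intro g l
    obtain ⟨a, rfl⟩ := φ.surjective g
    obtain ⟨b, p, rfl⟩ := word_surjective φ ψ a l
    have hsum : ∀ (n : ℕ) (f : ℕ → PathCoalgebra k V ⊗[k] PathCoalgebra k V),
        ∑ i ∈ Finset.range n, f i = ((List.range n).map f).sum := fun n f => rfl
    have h := congrArg (fun L => (L.map fun t => wordBasis φ ψ k t.1 ⊗ₜ[k] wordBasis φ ψ k t.2).sum)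
      (map_word_splits φ ψ p)
    simp only [List.map_map, Function.comp_def] at h
    rw [wordBasis_word, comul_ofPath, comulPath, hsum, ← h]
    simp only [wordBasis_word]
  · intro g l
    obtain ⟨a, rfl⟩ := φ.surjective g
    obtain ⟨b, p, rfl⟩ := word_surjective φ ψ a l
    rw [wordBasis_word, counit_ofPath, counitPath, ← length_word φ ψ]
    simp [List.length_eq_zero_iff]

end Words

end PathCoalgebra

/-! ### Group-like and skew-primitive elements of path coalgebras -/

namespace PathCoalgebra

variable {V : Type u} [Quiver.{w} V]

theorem comp_of_mem_splits {a b : V} (p : Quiver.Path a b) {s} (hs : s ∈ splits p) :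
    s.2.2.comp s.2.1 = p := by
  induction p with
  | nil =>
    obtain rfl := List.mem_singleton.1 hs
    rfl
  | cons p e ih =>
    rcases List.mem_cons.1 hs with rfl | hs
    · rfl
    · obtain ⟨t, ht, rfl⟩ := List.mem_map.1 hs
      exact congrArg (·.cons e) (ih ht)

theorem mem_splits_comp {a b c : V} (r : Quiver.Path a b) (q : Quiver.Path b c) :
    (⟨b, q, r⟩ : Σ d : V, Quiver.Path d c × Quiver.Path a d) ∈ splits (r.comp q) := by
  induction q with
  | nil => cases r <;> simp [splits]
  | cons q e ih => exact List.mem_cons_of_mem _ (List.mem_map.2 ⟨_, ih, rfl⟩)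

theorem nodup_splits {a b : V} (p : Quiver.Path a b) : (splits p).Nodup := by
  induction p with
  | nil => exact List.nodup_singleton _
  | cons p e ih =>
    refine List.nodup_cons.2 ⟨fun h => ?_, ih.map ?_⟩
    · obtain ⟨t, -, ht⟩ := List.mem_map.1 h
      have h := congrArg (fun s => s.2.1.length) ht
      simp at h
    · rintro ⟨d, q, r⟩ ⟨d', q', r'⟩ h
      simp only [Sigma.mk.injEq] at h
      obtain ⟨rfl, h⟩ := h
      simpa using h

variable (k : Type v) [Field k]

/-- The coordinate of an element of `kQ` at a path. -/
noncomputable def coord (p : PathIndex V) : PathCoalgebra k V →ₗ[k] k := (pathBasis k).coord p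

/-- The coordinate of an element of `kQ ⊗ kQ` at a pair of paths. -/
noncomputable def pairCoord (q r : PathIndex V) :
    PathCoalgebra k V ⊗[k] PathCoalgebra k V →ₗ[k] k :=
  LinearMap.mul' k k ∘ₗ TensorProduct.map (coord k q) (coord k r)

@[simp]
theorem pairCoord_tmul (q r : PathIndex V) (x y : PathCoalgebra k V) :
    pairCoord k q r (x ⊗ₜ y) = coord k q x * coord k r y := rfl

open Classical in
theorem coord_ofPath {a b : V} (q : PathIndex V) (p : Quiver.Path a b) :
    coord k q (ofPath k p) = if (⟨a, b, p⟩ : PathIndex V) = q then 1 else 0 := by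
  rw [coord, Module.Basis.coord_apply, ofPath, Module.Basis.repr_self, Finsupp.single_apply]

theorem ext_coord {x y : PathCoalgebra k V}
    (h : ∀ (a b : V) (p : Quiver.Path a b), coord k ⟨a, b, p⟩ x = coord k ⟨a, b, p⟩ y) : x = y :=
  (pathBasis k).ext_elem fun ⟨a, b, p⟩ => h a b p

theorem pairCoord_comul_of_ne {a b c d : V} (q : Quiver.Path c d) (r : Quiver.Path a b)
    (h : b ≠ c) (x : PathCoalgebra k V) :
    pairCoord k ⟨c, d, q⟩ ⟨a, b, r⟩ (Coalgebra.comul x) = 0 := by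
  classical
  refine LinearMap.congr_fun (f := pairCoord k ⟨c, d, q⟩ ⟨a, b, r⟩ ∘ₗ Coalgebra.comul) (g := 0)
    ((pathBasis k).ext fun ⟨a', d', p⟩ => ?_) x
  change pairCoord k _ _ (Coalgebra.comul (ofPath k p)) = 0
  rw [comul_ofPath, comulPath, map_list_sum, List.map_map]
  refine List.sum_eq_zero fun t ht => ?_
  obtain ⟨⟨e, q', r'⟩, -, rfl⟩ := List.mem_map.1 ht
  simp only [Function.comp_apply, pairCoord_tmul, coord_ofPath, mul_ite, mul_one, mul_zero]
  rw [ite_eq_right_iff]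
  intro h₁
  rw [ite_eq_right_iff]
  intro h₂
  cases h₁
  cases h₂
  exact absurd rfl h

/-- A path `r.comp q` splits into `q` and `r` exactly once, and no other path does. -/
theorem pairCoord_comul_comp {a b c : V} (r : Quiver.Path a b) (q : Quiver.Path b c)
    (x : PathCoalgebra k V) :
    pairCoord k ⟨b, c, q⟩ ⟨a, b, r⟩ (Coalgebra.comul x) = coord k ⟨a, c, r.comp q⟩ x := by
  classical
  refine LinearMap.congr_fun (f := pairCoord k ⟨b, c, q⟩ ⟨a, b, r⟩ ∘ₗ Coalgebra.comul)
    ((pathBasis k).ext fun ⟨a', c', p⟩ => ?_) x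
  change pairCoord k _ _ (Coalgebra.comul (ofPath k p)) = coord k _ (ofPath k p)
  rw [comul_ofPath, comulPath, map_list_sum, List.map_map, coord_ofPath]
  by_cases hac : a' = a ∧ c' = c
  · obtain ⟨rfl, rfl⟩ := hac
    have h : ((pairCoord k ⟨b, c', q⟩ ⟨a', b, r⟩) ∘ fun s : Σ d : V, Quiver.Path d c' ×
        Quiver.Path a' d => ofPath k s.2.1 ⊗ₜ[k] ofPath k s.2.2) =
        fun s => if s = ⟨b, q, r⟩ then 1 else 0 := by
      funext ⟨d, q', r'⟩
      simp only [Function.comp_apply, pairCoord_tmul, coord_ofPath]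
      by_cases hd : d = b
      · subst hd
        by_cases h₁ : q' = q <;> by_cases h₂ : r' = r <;> simp [h₁, h₂]
      · simp [hd]
    have hmem : (⟨b, q, r⟩ : Σ d : V, Quiver.Path d c' × Quiver.Path a' d) ∈ splits p ↔
        (⟨a', c', p⟩ : PathIndex V) = ⟨a', c', r.comp q⟩ := by
      refine ⟨fun h => by rw [comp_of_mem_splits p h], fun h => ?_⟩
      obtain rfl : p = r.comp q := by simpa using h
      exact mem_splits_comp r q
    rw [h, List.sum_map_eq_nsmul_single (⟨b, q, r⟩ : Σ d : V, Quiver.Path d c' × Quiver.Path a' d)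
      (fun s => if s = ⟨b, q, r⟩ then (1 : k) else 0) fun s hs _ => if_neg hs,
      (nodup_splits p).count, if_pos rfl, ite_smul, one_smul, zero_smul]
    exact if_congr hmem rfl rfl
  · rw [if_neg (by rintro h; cases h; exact hac ⟨rfl, rfl⟩)]
    refine List.sum_eq_zero fun t ht => ?_
    obtain ⟨⟨e, q', r'⟩, -, rfl⟩ := List.mem_map.1 ht
    simp only [Function.comp_apply, pairCoord_tmul, coord_ofPath, mul_ite, mul_one, mul_zero]
    rw [ite_eq_right_iff]
    intro h₁
    rw [ite_eq_right_iff]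
    intro h₂
    cases h₁
    cases h₂
    exact absurd ⟨rfl, rfl⟩ hac

/-- A vertex as an element of the path coalgebra. -/
noncomputable abbrev vertex (a : V) : PathCoalgebra k V := ofPath k (.nil : Quiver.Path a a)

open Classical in
theorem coord_nil_vertex (a b : V) :
    coord k ⟨b, b, .nil⟩ (vertex k a) = if a = b then 1 else 0 := by
  rw [coord_ofPath]
  refine if_congr ⟨fun h => congrArg Sigma.fst h, ?_⟩ rfl rfl
  rintro rfl
  rfl

theorem coord_cons_vertex (a : V) {b c d : V} (p : Quiver.Path b c) (e : c ⟶ d) :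
    coord k ⟨b, d, p.cons e⟩ (vertex k a) = 0 := by
  classical
  rw [coord_ofPath, if_neg]
  intro h
  have h := congrArg (fun p : PathIndex V => p.2.2.length) h
  simp at h

theorem vertex_injective : Function.Injective (vertex k : V → PathCoalgebra k V) := by
  classical
  intro a b h
  have h := congrArg (coord k ⟨b, b, .nil⟩) h
  by_contra hab
  simp [coord_nil_vertex, hab] at h

theorem isGroupLikeElem_vertex (a : V) : IsGroupLikeElem k (vertex k a) :=
  ⟨by simp [counitPath], by rw [comul_ofPath, comulPath_nil]⟩

/-- If `p` is a longest path in a group-like element `g`, then `p p` also occurs in `g`, since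
`Δ(g) = g ⊗ g`; so `p` is a vertex. -/
theorem exists_vertex_of_isGroupLikeElem {g : PathCoalgebra k V} (hg : IsGroupLikeElem k g) :
    ∃ a, vertex k a = g := by
  classical
  have hΔ : ∀ q r, pairCoord k q r (Coalgebra.comul g) = coord k q g * coord k r g := fun q r => by
    rw [hg.comul_eq_tmul_self, pairCoord_tmul]
  have hlen : ∀ p, coord k p g ≠ 0 → p.2.2.length = 0 := by
    intro p hp
    obtain ⟨⟨a, b, m⟩, hm, hmax⟩ := ((pathBasis k).repr g).support.exists_max_image
      (fun p => p.2.2.length) ⟨p, Finsupp.mem_support_iff.2 hp⟩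
    have hm : coord k ⟨a, b, m⟩ g ≠ 0 := Finsupp.mem_support_iff.1 hm
    have hmm := hΔ ⟨a, b, m⟩ ⟨a, b, m⟩
    by_cases hab : b = a
    · subst hab
      rw [pairCoord_comul_comp] at hmm
      have h₁ := hmax ⟨b, b, m.comp m⟩ (Finsupp.mem_support_iff.2 (hmm ▸ mul_ne_zero hm hm))
      have h₂ := hmax p (Finsupp.mem_support_iff.2 hp)
      simp only [Quiver.Path.length_comp] at h₁ h₂
      omega
    · rw [pairCoord_comul_of_ne k m m hab] at hmm
      exact absurd hmm.symm (mul_ne_zero hm hm)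
  obtain ⟨⟨a, b, p⟩, hp⟩ : ∃ p, coord k p g ≠ 0 := by
    by_contra! h
    exact hg.ne_zero (ext_coord k fun a b p => by rw [h, map_zero])
  cases p with
  | cons p e => exact absurd (hlen _ hp) (by simp)
  | nil =>
    have h1 : coord k ⟨a, a, .nil⟩ g = 1 := by
      have h := hΔ ⟨a, a, .nil⟩ ⟨a, a, .nil⟩
      rw [pairCoord_comul_comp] at h
      exact mul_left_cancel₀ hp (h.symm.trans (mul_one _).symm)
    refine ⟨a, ext_coord k fun b c q => ?_⟩
    cases q with
    | cons q e =>
      rw [coord_cons_vertex]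
      by_contra h
      exact absurd (hlen _ (Ne.symm h)) (by simp)
    | nil =>
      rw [coord_nil_vertex]
      split_ifs with hab
      · subst hab
        exact h1.symm
      · have h := hΔ ⟨b, b, .nil⟩ ⟨a, a, .nil⟩
        rw [pairCoord_comul_of_ne k _ _ hab, h1, mul_one] at h
        exact h

/-- An element `x` with `Δ(x) = b ⊗ x + x ⊗ a` has no paths of length at least `2` and no arrows
other than those from `a` to `b`. Without the latter, only a multiple of `b - a` is left. -/
theorem eq_smul_sub_of_skewPrimitive {a b : V} {x : PathCoalgebra k V}
    (hx : Coalgebra.comul (R := k) x = vertex k b ⊗ₜ[k] x + x ⊗ₜ[k] vertex k a)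
    (h₀ : ∀ e : a ⟶ b, coord k ⟨a, b, e.toPath⟩ x = 0) :
    ∃ t : k, x = t • (vertex k b - vertex k a) := by
  classical
  have hΔ : ∀ q r, pairCoord k q r (Coalgebra.comul x) =
      coord k q (vertex k b) * coord k r x + coord k q x * coord k r (vertex k a) := fun q r => by
    rw [hx, map_add, pairCoord_tmul, pairCoord_tmul]
  refine ⟨coord k ⟨b, b, .nil⟩ x, ext_coord k fun c d p => ?_⟩
  rw [map_smul, map_sub]
  cases p with
  | nil =>
    have h := hΔ ⟨c, c, .nil⟩ ⟨c, c, .nil⟩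
    rw [pairCoord_comul_comp, Quiver.Path.comp_nil, coord_nil_vertex, coord_nil_vertex] at h
    rw [coord_nil_vertex, coord_nil_vertex]
    -- For `a = b` the coordinate at `a` is twice itself; otherwise those at `a` and `b` add to `0`.
    by_cases hb : b = c <;> by_cases ha : a = c
    · subst hb
      simp_all
    · subst hb
      simp [ha]
    · subst ha
      have h' := hΔ ⟨b, b, .nil⟩ ⟨a, a, .nil⟩
      rw [pairCoord_comul_of_ne k _ _ (Ne.symm hb), coord_nil_vertex, coord_nil_vertex] at h'
      simp only [if_true, one_mul, mul_one] at h'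
      simp [hb, eq_neg_of_add_eq_zero_left h'.symm]
    · simpa [ha, hb] using h
  | cons p e =>
    rw [coord_cons_vertex, coord_cons_vertex, sub_zero, smul_zero]
    cases p with
    | nil =>
      have hb := hΔ ⟨d, d, .nil⟩ ⟨c, d, e.toPath⟩
      have ha := hΔ ⟨c, d, e.toPath⟩ ⟨c, c, .nil⟩
      rw [pairCoord_comul_comp, coord_nil_vertex] at ha hb
      rw [Quiver.Hom.toPath, coord_cons_vertex] at ha hb
      simp only [Quiver.Path.comp_nil, Quiver.Path.comp_cons, zero_mul,
        mul_zero, add_zero, zero_add] at ha hb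
      by_cases hac : a = c
      · by_cases hbd : b = d
        · subst hac hbd
          exact h₀ e
        · rwa [if_neg hbd, zero_mul] at hb
      · rwa [if_neg hac, mul_zero] at ha
    | cons p f =>
      have h := hΔ ⟨_, _, e.toPath⟩ ⟨_, _, p.cons f⟩
      rw [pairCoord_comul_comp, Quiver.Hom.toPath, coord_cons_vertex, coord_cons_vertex] at h
      simpa using h

end PathCoalgebra

/-! ### Convolution at group-like and skew-primitive elements -/

section Evaluation

variable {k : Type*} [Field k] {C : Type*} [AddCommGroup C] [Module k C] [Coalgebra k C]

theorem IsGroupLikeElem.tmul {D : Type*} [AddCommGroup D] [Module k D] [Coalgebra k D] {g : C}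
    {h : D} (hg : IsGroupLikeElem k g) (hh : IsGroupLikeElem k h) :
    IsGroupLikeElem k (g ⊗ₜ[k] h) :=
  ⟨by simp [hg.counit_eq_one, hh.counit_eq_one],
    by simp [hg.comul_eq_tmul_self, hh.comul_eq_tmul_self]⟩

theorem convLeft_isGroupLikeElem {M : Type*} [AddCommGroup M] [Module k M] (φ : C →ₗ[k] k)
    (f : C →ₗ[k] M) {g : C} (hg : IsGroupLikeElem k g) : convLeft φ f g = φ g • f g := by
  simp [convLeft, hg.comul_eq_tmul_self]

theorem convRight_isGroupLikeElem {M : Type*} [AddCommGroup M] [Module k M] (f : C →ₗ[k] M)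
    (φ : C →ₗ[k] k) {g : C} (hg : IsGroupLikeElem k g) : convRight f φ g = φ g • f g := by
  simp [convRight, hg.comul_eq_tmul_self]

theorem ConvDual.unit_apply_ne_zero (φ : (ConvDual k C)ˣ) {g : C} (hg : IsGroupLikeElem k g) :
    φ.val.ofConv g ≠ 0 := by
  intro h
  have h₁ : (φ.val * φ⁻¹.val).ofConv g = (1 : ConvDual k C).ofConv g := by rw [φ.mul_inv]
  have h₂ : (φ.val * φ⁻¹.val).ofConv g = φ.val.ofConv g * φ⁻¹.val.ofConv g := by
    change LinearMap.mul' k k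
      (TensorProduct.map φ.val.ofConv φ⁻¹.val.ofConv (Coalgebra.comul g)) = _
    rw [hg.comul_eq_tmul_self]
    rfl
  have h₃ : (1 : ConvDual k C).ofConv g = 1 := hg.counit_eq_one
  rw [h₂, h, zero_mul, h₃] at h₁
  exact zero_ne_one h₁

theorem smul_add_smul_of_skewPrimitive
    {N : Type*} [AddCommGroup N] [Module k N] {a b x : C}
    (hx : Coalgebra.comul (R := k) x = b ⊗ₜ[k] x + x ⊗ₜ[k] a) (f f' : C →ₗ[k] N) (φ : C →ₗ[k] k)
    (h : convRight f φ = convLeft φ f') :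
    φ x • f b + φ a • f x = φ b • f' x + φ x • f' a := by
  simpa [convLeft, convRight, hx] using LinearMap.congr_fun h x

theorem comul_tmul_of_skewPrimitive {D : Type*} [AddCommGroup D] [Module k D] [Coalgebra k D]
    {a b x : C} {g : D}
    (hx : Coalgebra.comul (R := k) x = b ⊗ₜ[k] x + x ⊗ₜ[k] a) (hg : IsGroupLikeElem k g) :
    Coalgebra.comul (R := k) (x ⊗ₜ[k] g) =
      (b ⊗ₜ[k] g) ⊗ₜ[k] (x ⊗ₜ[k] g) + (x ⊗ₜ[k] g) ⊗ₜ[k] (a ⊗ₜ[k] g) := by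
  simp [hx, hg.comul_eq_tmul_self, add_tmul]

end Evaluation

/-! ### The abelian group of vertices -/

namespace PathCoalgebra

variable {k : Type v} [Field k] {V : Type u} [Quiver.{w} V]

theorem exists_mul_vertex (M : MajidAlgebra k (PathCoalgebra k V)) (a b : V) :
    ∃ c, vertex k c = M.mul (vertex k a ⊗ₜ vertex k b) :=
  exists_vertex_of_isGroupLikeElem k
    (((isGroupLikeElem_vertex k a).tmul (isGroupLikeElem_vertex k b)).map M.mul)

theorem exists_S_vertex (M : MajidAlgebra k (PathCoalgebra k V)) (a : V) :
    ∃ c, vertex k c = M.S (vertex k a) := by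
  have hg := isGroupLikeElem_vertex k a
  refine exists_vertex_of_isGroupLikeElem k ⟨?_, ?_⟩
  · exact (LinearMap.congr_fun M.counit_S _).trans hg.counit_eq_one
  · refine (LinearMap.congr_fun M.comul_S _).trans ?_
    simp [hg.comul_eq_tmul_self]

theorem α_vertex_ne_zero (M : MajidAlgebra k (PathCoalgebra k V)) (a : V) :
    M.α (vertex k a) ≠ 0 := by
  intro h
  have hg := isGroupLikeElem_vertex k a
  have h₁ := LinearMap.congr_fun M.Φ_S (vertex k a)
  simp only [LinearMap.comp_apply, hg.comul_eq_tmul_self, LinearMap.lTensor_tmul,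
    TensorProduct.map_tmul, convRight_isGroupLikeElem _ _ hg, hg.counit_eq_one, h, zero_smul,
    zero_tmul, tmul_zero, map_zero] at h₁
  exact zero_ne_one h₁

theorem mul_vertex_assoc (M : MajidAlgebra k (PathCoalgebra k V)) (a b c : V) :
    M.mul (M.mul (vertex k a ⊗ₜ vertex k b) ⊗ₜ vertex k c) =
      M.mul (vertex k a ⊗ₜ M.mul (vertex k b ⊗ₜ vertex k c)) := by
  have hg := (isGroupLikeElem_vertex k a).tmul
    ((isGroupLikeElem_vertex k b).tmul (isGroupLikeElem_vertex k c))
  have h := LinearMap.congr_fun M.quasi_assoc (vertex k a ⊗ₜ (vertex k b ⊗ₜ vertex k c))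
  rw [convLeft_isGroupLikeElem _ _ hg, convRight_isGroupLikeElem _ _ hg] at h
  exact (smul_right_injective _ (ConvDual.unit_apply_ne_zero M.Φ hg) h).symm

theorem S_vertex_mul (M : MajidAlgebra k (PathCoalgebra k V)) (a : V) :
    M.mul (M.S (vertex k a) ⊗ₜ vertex k a) = M.one := by
  have hg := isGroupLikeElem_vertex k a
  have h := LinearMap.congr_fun M.S_α (vertex k a)
  simp only [LinearMap.comp_apply, hg.comul_eq_tmul_self, TensorProduct.map_tmul,
    convLeft_isGroupLikeElem _ _ hg, LinearMap.id_apply, tmul_smul, map_smul,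
    LinearMap.smulRight_apply] at h
  exact smul_right_injective _ (α_vertex_ne_zero M a) h

theorem mul_vertex_comm {M : MajidAlgebra k (PathCoalgebra k V)} (R : CoquasitriangularStructure M)
    (a b : V) : M.mul (vertex k a ⊗ₜ vertex k b) = M.mul (vertex k b ⊗ₜ vertex k a) := by
  have hg := (isGroupLikeElem_vertex k a).tmul (isGroupLikeElem_vertex k b)
  have h := LinearMap.congr_fun R.braided_comm (vertex k a ⊗ₜ vertex k b)
  rw [convLeft_isGroupLikeElem _ _ hg, convRight_isGroupLikeElem _ _ hg] at h
  exact (smul_right_injective _ (ConvDual.unit_apply_ne_zero R.R hg) h).symm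

/-- The multiplication of group-like elements makes the vertices an abelian group: on group-like
elements the associator, the universal `R`-form and `α` are nonzero scalars, so that they cancel
from quasi-associativity, braided commutativity and the antipode axiom. -/
theorem exists_commGroup {M : MajidAlgebra k (PathCoalgebra k V)}
    (R : CoquasitriangularStructure M) :
    ∃ _ : CommGroup V, vertex k (1 : V) = M.one ∧
      ∀ a b : V, vertex k (a * b) = M.mul (vertex k a ⊗ₜ vertex k b) := by
  choose m hm using exists_mul_vertex M
  choose s hs using exists_S_vertex M
  obtain ⟨e, he⟩ := exists_vertex_of_isGroupLikeElem k M.isGroupLikeElem_one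
  let _ : Mul V := ⟨m⟩
  let _ : One V := ⟨e⟩
  let _ : Inv V := ⟨s⟩
  have hmul : ∀ a b : V, vertex k (a * b) = M.mul (vertex k a ⊗ₜ vertex k b) := hm
  have hone : vertex k (1 : V) = M.one := he
  have hinv : ∀ a : V, vertex k a⁻¹ = M.S (vertex k a) := hs
  let _ : Group V := Group.ofLeftAxioms
    (fun a b c => vertex_injective k (by simp only [hmul, mul_vertex_assoc]))
    (fun a => vertex_injective k (by rw [hmul, hone, M.one_mul]))
    (fun a => vertex_injective k (by rw [hmul, hinv, S_vertex_mul, hone]))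
  exact ⟨{ mul_comm := fun a b => vertex_injective k (by rw [hmul, hmul, mul_vertex_comm R]) },
    hone, hmul⟩

/-! ### Translation of arrows -/

/-- Right multiplication by `z` maps combinations of arrows from `a` to `b` to skew-primitive
elements between `a z` and `b z`. Quasi-associativity on `x ⊗ z ⊗ z⁻¹` shows that multiplication by
`z⁻¹` undoes it, up to a nonzero scalar and a multiple of `b - a`. -/
theorem card_hom_le_card_hom_mul [CommGroup V] (hfin : ∀ x y : V, Finite (x ⟶ y))
    (M : MajidAlgebra k (PathCoalgebra k V)) (hone : vertex k (1 : V) = M.one)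
    (hmul : ∀ a b : V, vertex k (a * b) = M.mul (vertex k a ⊗ₜ vertex k b)) (a b z : V) :
    Nat.card (a ⟶ b) ≤ Nat.card (a * z ⟶ b * z) := by
  classical
  have := Fintype.ofFinite (a ⟶ b)
  have := Fintype.ofFinite (a * z ⟶ b * z)
  let L : ((a ⟶ b) →₀ k) →ₗ[k] PathCoalgebra k V :=
    Finsupp.linearCombination k fun e => ofPath k e.toPath
  -- Coordinates of `L f * z` at the arrows from `a z` to `b z`.
  let T : ((a ⟶ b) →₀ k) →ₗ[k] ((a * z ⟶ b * z) → k) :=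
    LinearMap.pi fun e => coord k ⟨_, _, e.toPath⟩ ∘ₗ M.mul.toLinearMap ∘ₗ
      (TensorProduct.mk k _ _).flip (vertex k z) ∘ₗ L
  have hL : ∀ f, Coalgebra.comul (R := k) (L f) = vertex k b ⊗ₜ[k] L f + L f ⊗ₜ[k] vertex k a := by
    intro f
    induction f using Finsupp.induction_linear with
    | zero => simp
    | add f₁ f₂ h₁ h₂ => simp only [map_add, h₁, h₂, tmul_add, add_tmul]; abel
    | single e c =>
      simp [L, Quiver.Hom.toPath, comulPath_cons, comulPath_nil, prolong_ofPath, smul_tmul']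
  have hcoord : ∀ f e, coord k ⟨a, b, e.toPath⟩ (L f) = f e := by
    intro f e
    induction f using Finsupp.induction_linear with
    | zero => simp
    | add f₁ f₂ h₁ h₂ => simp only [map_add, h₁, h₂, Finsupp.add_apply]
    | single e' c => simp [L, coord_ofPath, Finsupp.single_apply, Quiver.Hom.toPath]
  have hT : Function.Injective T := by
    refine (injective_iff_map_eq_zero T).2 fun f hf => ?_
    have hz := isGroupLikeElem_vertex k z
    have hz' := isGroupLikeElem_vertex k z⁻¹
    have hfz : Coalgebra.comul (R := k) (M.mul (L f ⊗ₜ vertex k z)) =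
        vertex k (b * z) ⊗ₜ[k] M.mul (L f ⊗ₜ vertex k z) +
          M.mul (L f ⊗ₜ vertex k z) ⊗ₜ[k] vertex k (a * z) := by
      rw [← CoalgHomClass.map_comp_comul_apply, comul_tmul_of_skewPrimitive (hL f) hz, hmul, hmul]
      simp
    obtain ⟨t, ht⟩ := eq_smul_sub_of_skewPrimitive k hfz fun e => congrFun hf e
    have hzz : M.mul (vertex k z ⊗ₜ vertex k z⁻¹) = M.one := by
      rw [← hmul, mul_inv_cancel, hone]
    have hcancel : ∀ c : V, M.mul (vertex k (c * z) ⊗ₜ vertex k z⁻¹) = vertex k c := fun c => by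
      rw [← hmul, mul_inv_cancel_right]
    have h : _ • M.mul (vertex k b ⊗ₜ M.mul (vertex k z ⊗ₜ vertex k z⁻¹)) +
        _ • M.mul (L f ⊗ₜ M.mul (vertex k z ⊗ₜ vertex k z⁻¹)) =
        _ • M.mul (M.mul (L f ⊗ₜ vertex k z) ⊗ₜ vertex k z⁻¹) +
          _ • M.mul (M.mul (vertex k a ⊗ₜ vertex k z) ⊗ₜ vertex k z⁻¹) :=
      smul_add_smul_of_skewPrimitive (comul_tmul_of_skewPrimitive (hL f) (hz.tmul hz')) _ _ _
        M.quasi_assoc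
    rw [hzz, M.mul_one, M.mul_one, ht, ← smul_tmul', sub_tmul, map_smul, map_sub, ← hmul a z,
      hcancel, hcancel] at h
    have hΦ := ConvDual.unit_apply_ne_zero M.Φ ((isGroupLikeElem_vertex k a).tmul (hz.tmul hz'))
    ext e
    have he := congrArg (coord k ⟨a, b, e.toPath⟩) h
    have hv : ∀ c, coord k ⟨a, b, e.toPath⟩ (vertex k c) = 0 := fun c =>
      coord_cons_vertex k c .nil e
    simp only [map_add, map_sub, map_smul, hcoord, hv] at he
    simpa [hΦ] using he
  have h := LinearMap.finrank_le_finrank_of_injective hT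
  rwa [Module.finrank_finsupp_self, Module.finrank_fintype_fun_eq_card, ← Nat.card_eq_fintype_card,
    ← Nat.card_eq_fintype_card] at h

theorem card_hom_mul [CommGroup V] (hfin : ∀ x y : V, Finite (x ⟶ y))
    (M : MajidAlgebra k (PathCoalgebra k V)) (hone : vertex k (1 : V) = M.one)
    (hmul : ∀ a b : V, vertex k (a * b) = M.mul (vertex k a ⊗ₜ vertex k b)) (a b z : V) :
    Nat.card (a * z ⟶ b * z) = Nat.card (a ⟶ b) := by
  refine le_antisymm ?_ (card_hom_le_card_hom_mul hfin M hone hmul a b z)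
  have h := card_hom_le_card_hom_mul hfin M hone hmul (a * z) (b * z) z⁻¹
  rwa [mul_inv_cancel_right, mul_inv_cancel_right] at h

end PathCoalgebra

theorem proposition3p1 (k : Type v) [Field k] (V : Type u) [Quiver.{w} V]
    (hfin : ∀ x y : V, Finite (x ⟶ y)) :
    AdmitsCoquasitriangularMajid k (PathCoalgebra k V) ↔
      ∃ (G : Type u) (_ : CommGroup G) (R : ConjClasses G → ℕ),
        Nonempty (QuiverIso V (HopfQuiver R)) := by
  constructor
  · rintro ⟨M, ⟨R⟩⟩
    obtain ⟨_, hone, hmul⟩ := PathCoalgebra.exists_commGroup R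
    -- In an abelian group a conjugacy class has a single element, so `C.out` is that element.
    refine ⟨V, inferInstance, fun C => Nat.card ((1 : V) ⟶ C.out), ⟨⟨Equiv.refl V, fun x y => ?_⟩⟩⟩
    have hout : (ConjClasses.mk (y * x⁻¹)).out = y * x⁻¹ :=
      isConj_iff_eq.1 (ConjClasses.mk_eq_mk_iff_isConj.1 (Quotient.out_eq _))
    refine Finite.equivFinOfCardEq ?_
    have h := PathCoalgebra.card_hom_mul hfin M hone hmul 1 (y * x⁻¹) x
    rw [one_mul, inv_mul_cancel_right] at h
    rw [h]
    exact congrArg (fun c => Nat.card ((1 : V) ⟶ c)) hout.symm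
  · rintro ⟨G, _, R, ⟨φ, ψ⟩⟩
    exact PathCoalgebra.admitsCoquasitriangularMajid_of_hopfQuiver
      (N := fun c => R (ConjClasses.mk c)) φ ψ k
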